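/- Let $\mathcal H$ be a complex Hilbert space of finite dimension and let $\mathcal W_1,\mathcal W_2,\ldots$ be a nonstationary quantum channel, i.e. a sequence of nonempty Borel sets of states (density operators) on $\mathcal H$; for example, $\mathcal W_i$ may be the set of all output states of a quantum operation with output system $\mathcal H$. All logarithms are to base $2$. An $n$-block code for this channel is a pair $(f,D)$ consisting of a map $f:\mathcal M\to\mathcal W_1\times\cdots\times\mathcal W_n$ on a nonempty finite set $\mathcal M$, where $(\rho_1,\ldots,\rho_n)$ is identified with the product state $\rho_1\otimes\cdots\otimes\rho_n$ on $\mathcal H^{\otimes n}$, and an observable $D=(D_m)_{m\in\mathcal M'}$ with countable index set $\mathcal M'\supseteq\mathcal M$, i.e. a family of positive semidefinite operators on $\mathcal H^{\otimes n}$ with $\sum_{m\in\mathcal M'}D_m=\mathbf 1$. Its maximum error probability is $e(f,D)=\max_{m\in\mathcal M}\bigl(1-\operatorname{Tr}(f(m)D_m)\bigr)$. For $\lambda\in(0,1)$ let $N(n,\lambda)$ be the maximal size $|\mathcal M|$ of an $n$-block code with $e(f,D)\le\lambda$. For a Borel probability distribution $P$ on $\mathcal W_i$ put $$I(P;\mathcal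 W_i)=H(P\mathcal W_i)-H(\mathcal W_i|P),\qquad P\mathcal W_i=\int\rho\,dP(\rho),\qquad H(\mathcal W_i|P)=\int H(\rho)\,dP(\rho),$$ where $H(\rho)=-\operatorname{Tr}(\rho\log\rho)$ is the von Neumann entropy, and let $C(\mathcal W_i)=\sup_P I(P;\mathcal W_i)$, the supremum over all Borel probability distributions $P$ on $\mathcal W_i$. **Theorem.** For every $\lambda\in(0,1)$ the maximum $N(n,\lambda)$ exists for every $n$, the supremum $C(\mathcal W_i)$ is finite for every $i$, and $$\left|\frac1n\log N(n,\lambda)-\frac1n\sum_{i=1}^n C(\mathcal W_i)\right|\longrightarrow 0\qquad\text{as }n\to\infty.$$ -/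

import Mathlib

open Filter Topology MeasureTheory
open scoped ComplexOrder

noncomputable section

namespace QChannel

/-- The states (density operators) on the algebra of operators on `ℂ^ι`: positive semidefinite
complex matrices of trace one. -/
structure DensityOperator (ι : Type*) [Fintype ι] where
  mat : Matrix ι ι ℂ
  posSemidef : mat.PosSemidef
  trace_eq_one : mat.trace = 1

namespace DensityOperator

variable {ι : Type*} [Fintype ι]

/-- The topology of entrywise convergence (the norm topology). -/
instance : TopologicalSpace (DensityOperator ι) :=
  TopologicalSpace.induced DensityOperator.mat inferInstance

instance : MeasurableSpace (DensityOperator ι) := borel _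

instance : BorelSpace (DensityOperator ι) := ⟨rfl⟩

lemma continuous_entry (a b : ι) : Continuous fun ρ : DensityOperator ι => ρ.mat a b :=
  (continuous_apply_apply a b).comp continuous_induced_dom

lemma sum_diag_re (ρ : DensityOperator ι) : ∑ a, (ρ.mat a a).re = 1 := by
  have h := congrArg Complex.re ρ.trace_eq_one
  simpa [Matrix.trace] using h

lemma diag_nonneg (ρ : DensityOperator ι) (a : ι) : 0 ≤ ρ.mat a a := by
  classical
  exact ρ.posSemidef.diag_nonneg

lemma diag_re_le_one (ρ : DensityOperator ι) (a : ι) : (ρ.mat a a).re ≤ 1 := by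
  rw [← sum_diag_re ρ]
  exact Finset.single_le_sum (f := fun a => (ρ.mat a a).re)
    (fun b _ => (Complex.le_def.1 (diag_nonneg ρ b)).1) (Finset.mem_univ a)

lemma norm_entry_le (ρ : DensityOperator ι) (a b : ι) : ‖ρ.mat a b‖ ≤ 2 := by
  classical
  have key : ∀ z : ℂ, ‖z‖ = 1 → -1 ≤ (z * ρ.mat a b).re := by
    intro z hz
    have h := (Complex.le_def.1 (ρ.posSemidef.dotProduct_mulVec_nonneg
      (Pi.single a 1 + Pi.single b z : ι → ℂ))).1
    have hba : ρ.mat b a = star (ρ.mat a b) := (ρ.posSemidef.1.apply b a).symm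
    have hzz : star z * z = 1 := by
      have := Complex.normSq_eq_conj_mul_self (z := z)
      rw [Complex.star_def, ← this, Complex.normSq_eq_norm_sq, hz]; simp
    have e : star (Pi.single a 1 + Pi.single b z : ι → ℂ) ⬝ᵥ
        (ρ.mat.mulVec (Pi.single a 1 + Pi.single b z)) =
        ρ.mat a a + z * ρ.mat a b + star (z * ρ.mat a b) + star z * z * ρ.mat b b := by
      have hs : star (Pi.single a 1 + Pi.single b z : ι → ℂ)
          = Pi.single a 1 + Pi.single b (star z) := by
        simp [star_add]
      rw [hs, Matrix.mulVec_add, dotProduct_add, add_dotProduct, add_dotProduct]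
      simp [Matrix.mulVec_single, hba]
      ring
    rw [e, hzz] at h
    have ha := diag_re_le_one ρ a
    have hb := diag_re_le_one ρ b
    simp only [Complex.add_re, Complex.zero_re, one_mul, Complex.star_def, Complex.conj_re] at h
    linarith
  have h1 := key 1 (by simp)
  have h2 := key (-1) (by simp)
  have h3 := key Complex.I (by simp)
  have h4 := key (-Complex.I) (by simp)
  simp at h1 h2 h3 h4
  calc ‖ρ.mat a b‖ ≤ |(ρ.mat a b).re| + |(ρ.mat a b).im| := Complex.norm_le_abs_re_add_abs_im _
    _ ≤ 1 + 1 := add_le_add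
        (abs_le.2 ⟨by linarith, by linarith⟩)
        (abs_le.2 ⟨by linarith, by linarith⟩)
    _ = 2 := by norm_num

lemma integrable_entry (P : ProbabilityMeasure (DensityOperator ι)) (a b : ι) :
    Integrable (fun ρ : DensityOperator ι => ρ.mat a b) (P : Measure (DensityOperator ι)) :=
  Integrable.of_bound (continuous_entry a b).measurable.aestronglyMeasurable 2
    (Eventually.of_forall fun ρ => norm_entry_le ρ a b)

/-- The average state `∫ ρ dP(ρ)` of a probability distribution on states. -/
def mean (P : ProbabilityMeasure (DensityOperator ι)) : DensityOperator ι :=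
  ⟨Matrix.of fun a b => ∫ ρ, ρ.mat a b ∂(P : Measure (DensityOperator ι)), by
    refine Matrix.PosSemidef.of_dotProduct_mulVec_nonneg ?_ ?_
    · ext a b
      simp only [Matrix.conjTranspose_apply, Matrix.of_apply, Complex.star_def]
      rw [← integral_conj]
      exact integral_congr_ae (Eventually.of_forall fun ρ => ρ.posSemidef.1.apply a b)
    · intro x
      have e : star x ⬝ᵥ ((Matrix.of fun a b =>
            ∫ ρ, ρ.mat a b ∂(P : Measure (DensityOperator ι))).mulVec x) =
          ∫ ρ, star x ⬝ᵥ (ρ.mat.mulVec x) ∂(P : Measure (DensityOperator ι)) := by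
        simp only [dotProduct, Matrix.mulVec, Matrix.of_apply]
        rw [integral_finsetSum]
        · refine Finset.sum_congr rfl fun a _ => ?_
          rw [integral_const_mul, integral_finsetSum]
          · refine congrArg _ (Finset.sum_congr rfl fun b _ => ?_)
            rw [integral_mul_const]
          · exact fun b _ => (integrable_entry P a b).mul_const _
        · exact fun a _ => (integrable_finsetSum _ fun b _ =>
            (integrable_entry P a b).mul_const _).const_mul _
      rw [e]
      exact integral_nonneg fun ρ => ρ.posSemidef.dotProduct_mulVec_nonneg x, by
      simp only [Matrix.trace, Matrix.diag, Matrix.of_apply]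
      rw [← integral_finsetSum _ fun a _ => integrable_entry P a a]
      have : ∀ ρ : DensityOperator ι, ∑ a, ρ.mat a a = 1 := fun ρ => ρ.trace_eq_one
      simp [this]⟩

/-- The von Neumann entropy `H(ρ) = -Tr (ρ log ρ)`, logarithm to base two, computed from the
eigenvalues of `ρ`, with `0 log 0 = 0`. -/
def entropy [DecidableEq ι] (ρ : DensityOperator ι) : ℝ :=
  -∑ j, ρ.posSemidef.1.eigenvalues j * Real.logb 2 (ρ.posSemidef.1.eigenvalues j)

/-- The product state `ρ₁ ⊗ ⋯ ⊗ ρₙ` on `(ℂ^ι)^{⊗ n} = ℂ^(ι^n)`. -/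
def tensor {n : ℕ} (ρ : Fin n → DensityOperator ι) : Matrix (Fin n → ι) (Fin n → ι) ℂ :=
  Matrix.of fun a b => ∏ i, (ρ i).mat (a i) (b i)

end DensityOperator

variable {ι : Type*} [Fintype ι] [DecidableEq ι]

/-- `I(P; 𝒲) = H(P𝒲) - H(𝒲|P)`, where `P𝒲 = ∫ ρ dP` and `H(𝒲|P) = ∫ H(ρ) dP`. -/
def holevoInformation (P : ProbabilityMeasure (DensityOperator ι)) : ℝ :=
  (DensityOperator.mean P).entropy - ∫ ρ, ρ.entropy ∂(P : Measure (DensityOperator ι))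

/-- The values `I(P; 𝒲)`, for all Borel probability distributions `P` on `𝒲`. -/
def informationValues (𝒲 : Set (DensityOperator ι)) : Set ℝ :=
  {x | ∃ P : ProbabilityMeasure (DensityOperator ι),
    (P : Measure (DensityOperator ι)) 𝒲ᶜ = 0 ∧ x = holevoInformation P}

/-- The Holevo capacity `C(𝒲) = sup_P I(P; 𝒲)`. -/
def capacity (𝒲 : Set (DensityOperator ι)) : ℝ :=
  sSup (informationValues 𝒲)

/-- An `n`-block code for the sequence `𝒲 0, 𝒲 1, …` of sets of states: an encoding of a finite
set of messages into product states with `i`-th factor from `𝒲 i`, `i < n`, and an observable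
(a partition of the identity into countably many positive operators) on `(ℂ^ι)^{⊗ n}`,
whose index set contains the message set. -/
structure BlockCode (𝒲 : ℕ → Set (DensityOperator ι)) (n : ℕ) where
  Index : Type
  countable_index : Countable Index
  messages : Finset Index
  messages_nonempty : messages.Nonempty
  encode : messages → (i : Fin n) → 𝒲 i
  observable : Index → Matrix (Fin n → ι) (Fin n → ι) ℂ
  observable_nonneg : ∀ m, (observable m).PosSemidef
  observable_sum : HasSum observable 1

variable {𝒲 : ℕ → Set (DensityOperator ι)} {n : ℕ}

/-- The probability `Tr (f(m) D_m)` that the message `m` is decoded correctly. -/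
def BlockCode.successProb (c : BlockCode 𝒲 n) (m : c.messages) : ℝ :=
  (Matrix.trace (DensityOperator.tensor (fun i => (c.encode m i : DensityOperator ι)) *
    c.observable m)).re

/-- The maximum error probability `e(f, D) = max_m (1 - Tr (f(m) D_m))`. -/
def BlockCode.maxError (c : BlockCode 𝒲 n) : ℝ :=
  c.messages.attach.sup' (Finset.attach_nonempty_iff.2 c.messages_nonempty)
    fun m => 1 - c.successProb m

/-- The sizes of the `(n, lam)`-codes, i.e. of the `n`-block codes of maximum error at most
`lam`. -/
def codeSizes (𝒲 : ℕ → Set (DensityOperator ι)) (n : ℕ) (lam : ℝ) : Set ℕ :=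
  {k | ∃ c : BlockCode 𝒲 n, c.maxError ≤ lam ∧ k = c.messages.card}

/-- `N(n, lam)`, the maximal size of an `(n, lam)`-code. -/
def maxCodeSize (𝒲 : ℕ → Set (DensityOperator ι)) (n : ℕ) (lam : ℝ) : ℕ :=
  sSup (codeSizes 𝒲 n lam)

end QChannel

end

/-! Both halves are governed by the divergence `crossEntropy ρ σ - ρ.entropy`. The law of large
numbers enters only through Chebyshev's inequality, so the letter sets may vary with the position as
long as second moments are bounded uniformly.

Converse: each `𝒲 i` has a centre `σ i`, with divergence at most `capacity (𝒲 i)` plus a small error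
from every state of `𝒲 i`, and with eigenvalues above a constant depending only on the error and the
dimension (`exists_divergence_center`). A test that accepts a code word with probability at least `1
- lam` must then accept the product of the `σ i` with probability about `2 ^ (-∑ capacity (𝒲 i))`
(`strong_converse_testing`). Under this one state the acceptance probabilities of all messages add
up to at most 1, which bounds the number of messages for every `lam < 1`.

Direct part: take finite ensembles with averages `τ i` and mean entropies `h i` that nearly attain
the capacities, and a code that cannot be enlarged among those whose decoding operators have trace
at most about `2 ^ ∑ h i`. The sum `B` of its operators catches a fixed share of every product state
of entropy at most about `∑ h i`; otherwise `√(1 - B) E √(1 - B)`, with `E` a typical projection,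
would decode one more word (`le_trace_of_maximal`). Averaging over the ensembles, `B` catches a
fixed share of the product of the `τ i`, so its trace is at least about `2 ^ ∑ (τ i).entropy`.
Comparing traces bounds the code size below (`le_maxCodeSize`). -/

noncomputable section

namespace QChannel

open Matrix

/-! ### Matrices diagonal in a given orthonormal basis; monotonicity of the logarithm -/

section Linear

variable {κ : Type*} [Fintype κ]

/-- The `a`-th diagonal entry (real part) of `E` in the basis of the columns of `U`. -/
def diagIn (U E : Matrix κ κ ℂ) (a : κ) : ℝ := ((Uᴴ * E * U) a a).re

lemma diagIn_nonneg {U E : Matrix κ κ ℂ} (hE : E.PosSemidef) (a : κ) : 0 ≤ diagIn U E a :=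
  (Complex.le_def.1 (hE.conjTranspose_mul_mul_same U).diag_nonneg).1

lemma diagIn_add (U E F : Matrix κ κ ℂ) (a : κ) :
    diagIn U (E + F) a = diagIn U E a + diagIn U F a := by
  simp [diagIn, Matrix.mul_add, Matrix.add_mul]

variable [DecidableEq κ]

lemma diagIn_smul (U E : Matrix κ κ ℂ) (c : ℝ) (a : κ) :
    diagIn U (c • E) a = c * diagIn U E a := by
  simp [diagIn]

lemma diagIn_one {U : Matrix κ κ ℂ} (hU : Uᴴ * U = 1) (a : κ) : diagIn U 1 a = 1 := by
  simp [diagIn, hU]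

lemma diagIn_le_one {U E : Matrix κ κ ℂ} (hU : Uᴴ * U = 1) (hE : (1 - E).PosSemidef) (a : κ) :
    diagIn U E a ≤ 1 := by
  have h := diagIn_add U (1 - E) E a
  rw [sub_add_cancel, diagIn_one hU] at h
  linarith [diagIn_nonneg (U := U) hE a]

lemma sum_diagIn {U : Matrix κ κ ℂ} (hU : Uᴴ * U = 1) (E : Matrix κ κ ℂ) :
    ∑ a, diagIn U E a = (trace E).re := by
  have h : trace (Uᴴ * E * U) = trace E := by
    rw [trace_mul_comm, ← Matrix.mul_assoc, mul_eq_one_comm.1 hU, Matrix.one_mul]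
  rw [← h, trace, Complex.re_sum]
  rfl

/-- The matrix with eigenvalues `d` on the columns of `U`. -/
def diagMat (U : Matrix κ κ ℂ) (d : κ → ℝ) : Matrix κ κ ℂ :=
  U * diagonal (fun a => (d a : ℂ)) * Uᴴ

/-- Reduces traces against an operator with known eigenbasis to real sums, so that the later
estimates become classical. -/
lemma trace_diagMat_mul (U E : Matrix κ κ ℂ) (d : κ → ℝ) :
    (trace (diagMat U d * E)).re = ∑ a, d a * diagIn U E a := by
  have h : trace (diagMat U d * E) = trace (diagonal (fun a => (d a : ℂ)) * (Uᴴ * E * U)) := by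
    rw [diagMat, Matrix.mul_assoc, Matrix.mul_assoc, trace_mul_comm]
    simp only [Matrix.mul_assoc]
  rw [h, trace, Complex.re_sum]
  refine Finset.sum_congr rfl fun a _ => ?_
  simp [diagonal_mul, diagIn]

lemma diagMat_posSemidef (U : Matrix κ κ ℂ) {d : κ → ℝ} (hd : ∀ a, 0 ≤ d a) :
    (diagMat U d).PosSemidef := by
  refine PosSemidef.mul_mul_conjTranspose_same ?_ U
  exact PosSemidef.diagonal fun a => by simpa using hd a

lemma diagMat_isHermitian (U : Matrix κ κ ℂ) (d : κ → ℝ) : (diagMat U d)ᴴ = diagMat U d := by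
  simp only [diagMat, conjTranspose_mul, conjTranspose_conjTranspose, diagonal_conjTranspose,
    Matrix.mul_assoc]
  congr 3
  ext a
  simp

lemma diagMat_mul {U : Matrix κ κ ℂ} (hU : Uᴴ * U = 1) (d e : κ → ℝ) :
    diagMat U d * diagMat U e = diagMat U (fun a => d a * e a) := by
  have : diagMat U d * diagMat U e = U * diagonal (fun a => (d a : ℂ)) * (Uᴴ * U) *
      diagonal (fun a => (e a : ℂ)) * Uᴴ := by
    simp only [diagMat, Matrix.mul_assoc]
  rw [this, hU, Matrix.mul_one, Matrix.mul_assoc U, diagonal_mul_diagonal]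
  simp [diagMat]

lemma diagMat_one {U : Matrix κ κ ℂ} (hU : Uᴴ * U = 1) : diagMat U (fun _ => 1) = 1 := by
  simp [diagMat, mul_eq_one_comm.1 hU]

lemma diagMat_add (U : Matrix κ κ ℂ) (d e : κ → ℝ) :
    diagMat U (fun a => d a + e a) = diagMat U d + diagMat U e := by
  simp only [diagMat, ← Matrix.add_mul, ← Matrix.mul_add, diagonal_add]
  simp

lemma diagMat_sub (U : Matrix κ κ ℂ) (d e : κ → ℝ) :
    diagMat U (fun a => d a - e a) = diagMat U d - diagMat U e := by
  rw [eq_sub_iff_add_eq, ← diagMat_add]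
  simp

lemma diagIn_diagMat {U : Matrix κ κ ℂ} (hU : Uᴴ * U = 1) (d : κ → ℝ) (a : κ) :
    diagIn U (diagMat U d) a = d a := by
  have : Uᴴ * diagMat U d * U = (Uᴴ * U) * diagonal (fun a => (d a : ℂ)) * (Uᴴ * U) := by
    simp only [diagMat, Matrix.mul_assoc]
  rw [diagIn, this, hU]
  simp

lemma trace_diagMat {U : Matrix κ κ ℂ} (hU : Uᴴ * U = 1) (d : κ → ℝ) :
    (trace (diagMat U d)).re = ∑ a, d a := by
  simp [← sum_diagIn hU, diagIn_diagMat hU]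

/-- The eigenvector unitary of a Hermitian matrix, as a matrix. -/
def eigU {A : Matrix κ κ ℂ} (hA : A.IsHermitian) : Matrix κ κ ℂ := hA.eigenvectorUnitary

lemma eigU_unitary {A : Matrix κ κ ℂ} (hA : A.IsHermitian) : (eigU hA)ᴴ * eigU hA = 1 :=
  (mem_unitaryGroup_iff').1 hA.eigenvectorUnitary.2

lemma eq_diagMat {A : Matrix κ κ ℂ} (hA : A.IsHermitian) :
    A = diagMat (eigU hA) hA.eigenvalues :=
  hA.spectral_theorem

lemma trace_mul_re_nonneg {A B : Matrix κ κ ℂ} (hA : A.PosSemidef) (hB : B.PosSemidef) :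
    0 ≤ (trace (A * B)).re := by
  rw [eq_diagMat hA.1, trace_diagMat_mul]
  exact Finset.sum_nonneg fun a _ => mul_nonneg (hA.eigenvalues_nonneg a) (diagIn_nonneg hB a)

section LogMono
open scoped MatrixOrder Matrix.Norms.L2Operator

lemma cfc_log_eq {A : Matrix κ κ ℂ} (hA : A.IsHermitian) :
    CFC.log A = diagMat (eigU hA) (fun a => Real.log (hA.eigenvalues a)) := by
  rw [CFC.log, hA.cfc_eq]
  rfl

/-- Operator monotonicity of the logarithm applied to `A ≤ c • B`, with `CFC.log` written out in
eigenbases. -/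
lemma diagMat_log_le {A B : Matrix κ κ ℂ} (hA : A.PosDef) (hB : B.PosDef) {c : ℝ} (hc : 0 < c)
    (h : (c • B - A).PosSemidef) :
    (diagMat (eigU hB.1) (fun a => Real.log (hB.1.eigenvalues a)) + Real.log c • 1 -
      diagMat (eigU hA.1) (fun a => Real.log (hA.1.eigenvalues a))).PosSemidef := by
  have h1 : A ≤ c • B := h
  have h2 := CFC.log_le_log h1 (Matrix.isStrictlyPositive_iff_posDef.2 hA)
  rw [CFC.log_smul' B hc (Matrix.isStrictlyPositive_iff_posDef.2 hB), cfc_log_eq hA.1,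
    cfc_log_eq hB.1, add_comm, Algebra.algebraMap_eq_smul_one] at h2
  exact h2

end LogMono

end Linear

/-! ### Entropy, cross entropy and Klein's inequality -/

namespace DensityOperator

variable {ι : Type*} [Fintype ι] [DecidableEq ι]

/-- A unitary whose columns are eigenvectors of `ρ`. -/
def basis (ρ : DensityOperator ι) : Matrix ι ι ℂ := eigU ρ.posSemidef.1

/-- The eigenvalues of `ρ`. -/
def eig (ρ : DensityOperator ι) : ι → ℝ := ρ.posSemidef.1.eigenvalues

lemma basis_unitary (ρ : DensityOperator ι) : (basis ρ)ᴴ * basis ρ = 1 := eigU_unitary _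

lemma mat_eq (ρ : DensityOperator ι) : ρ.mat = diagMat ρ.basis ρ.eig := eq_diagMat _

lemma eig_nonneg (ρ : DensityOperator ι) (a : ι) : 0 ≤ ρ.eig a := ρ.posSemidef.eigenvalues_nonneg a

lemma diagIn_basis (ρ : DensityOperator ι) (a : ι) : diagIn ρ.basis ρ.mat a = ρ.eig a := by
  conv_lhs => rw [mat_eq ρ]
  exact diagIn_diagMat ρ.basis_unitary _ a

lemma sum_diagIn_eq_one (ρ : DensityOperator ι) {U : Matrix ι ι ℂ} (hU : Uᴴ * U = 1) :
    ∑ a, diagIn U ρ.mat a = 1 := by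
  rw [sum_diagIn hU, ρ.trace_eq_one, Complex.one_re]

lemma sum_eig (ρ : DensityOperator ι) : ∑ a, ρ.eig a = 1 := by
  simp [← diagIn_basis, sum_diagIn_eq_one ρ ρ.basis_unitary]

lemma eig_le_one (ρ : DensityOperator ι) (a : ι) : ρ.eig a ≤ 1 := by
  rw [← sum_eig ρ]
  exact Finset.single_le_sum (fun b _ => eig_nonneg ρ b) (Finset.mem_univ a)

lemma entropy_eq (ρ : DensityOperator ι) :
    ρ.entropy = -∑ a, ρ.eig a * Real.logb 2 (ρ.eig a) := rfl

/-- `-Tr (ρ log σ)`. -/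
def crossEntropy (ρ σ : DensityOperator ι) : ℝ :=
  -∑ a, diagIn σ.basis ρ.mat a * Real.logb 2 (σ.eig a)

lemma crossEntropy_self (ρ : DensityOperator ι) : crossEntropy ρ ρ = ρ.entropy := by
  simp only [crossEntropy, diagIn_basis, entropy_eq]

/-- For unitary `U` the weights form a doubly stochastic matrix, by the next two lemmas; this
carries the noncommutative content of Klein's inequality. -/
lemma diagIn_mat_eq (ρ : DensityOperator ι) (U : Matrix ι ι ℂ) (a : ι) :
    diagIn U ρ.mat a = ∑ j, ρ.eig j * Complex.normSq ((ρ.basisᴴ * U) j a) := by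
  have : Uᴴ * ρ.mat * U = (ρ.basisᴴ * U)ᴴ * diagonal (fun a => (ρ.eig a : ℂ)) * (ρ.basisᴴ * U) := by
    conv_lhs => rw [mat_eq ρ]
    simp only [diagMat, conjTranspose_mul, conjTranspose_conjTranspose, Matrix.mul_assoc]
  rw [diagIn, this, Matrix.mul_apply, Complex.re_sum]
  refine Finset.sum_congr rfl fun j _ => ?_
  rw [mul_diagonal, conjTranspose_apply, mul_right_comm, mul_comm, Complex.star_def,
    ← Complex.normSq_eq_conj_mul_self, ← Complex.ofReal_mul, Complex.ofReal_re]

lemma sum_normSq_col {W : Matrix ι ι ℂ} (hW : Wᴴ * W = 1) (a : ι) :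
    ∑ j, Complex.normSq (W j a) = 1 := by
  have h := congrFun (congrFun hW a) a
  rw [Matrix.mul_apply, one_apply_eq] at h
  have h2 := congrArg Complex.re h
  rw [Complex.re_sum, Complex.one_re] at h2
  rw [← h2]
  refine Finset.sum_congr rfl fun j _ => ?_
  rw [conjTranspose_apply, Complex.star_def, ← Complex.normSq_eq_conj_mul_self, Complex.ofReal_re]

lemma sum_normSq_row {W : Matrix ι ι ℂ} (hW : Wᴴ * W = 1) (j : ι) :
    ∑ a, Complex.normSq (W j a) = 1 := by
  have h := sum_normSq_col (W := Wᴴ) (by simpa using mul_eq_one_comm.1 hW) j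
  simpa using h

/-- This is `log x ≤ x - 1` at `x = s / r`, multiplied by `r`. -/
lemma sub_le_mul_logb {r s : ℝ} (hr : 0 ≤ r) (hs : 0 < s) :
    (r - s) / Real.log 2 ≤ r * (Real.logb 2 r - Real.logb 2 s) := by
  have h2 : 0 < Real.log 2 := Real.log_pos one_lt_two
  rw [Real.logb, Real.logb, ← sub_div, mul_div_assoc', div_le_div_iff_of_pos_right h2]
  rcases hr.eq_or_lt with rfl | hr
  · simp [hs.le]
  · have h := Real.log_le_sub_one_of_pos (div_pos hs hr)
    rw [Real.log_div hs.ne' hr.ne'] at h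
    have h3 := mul_le_mul_of_nonneg_left h hr.le
    have : r * (s / r - 1) = s - r := by field_simp
    linarith

/-- Klein's inequality, relative to an arbitrary orthonormal basis. -/
lemma entropy_le_of_basis (ρ : DensityOperator ι) {U : Matrix ι ι ℂ} (hU : Uᴴ * U = 1)
    {s : ι → ℝ} (hs : ∀ a, 0 < s a) (hs1 : ∑ a, s a ≤ 1) :
    ρ.entropy ≤ -∑ a, diagIn U ρ.mat a * Real.logb 2 (s a) := by
  set W := ρ.basisᴴ * U with hWdef
  have hW : Wᴴ * W = 1 := by
    rw [hWdef, conjTranspose_mul, conjTranspose_conjTranspose, Matrix.mul_assoc,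
      ← Matrix.mul_assoc ρ.basis, mul_eq_one_comm.1 ρ.basis_unitary, Matrix.one_mul, hU]
  -- Both sides become averages over pairs `(j, a)` with the same doubly stochastic weights, so the
  -- scalar inequality applies pair by pair.
  have e1 : ρ.entropy = -∑ j, ∑ a, Complex.normSq (W j a) * (ρ.eig j * Real.logb 2 (ρ.eig j)) := by
    simp only [← Finset.sum_mul, sum_normSq_row hW, one_mul, entropy_eq]
  have e2 : ∑ a, diagIn U ρ.mat a * Real.logb 2 (s a) =
      ∑ j, ∑ a, Complex.normSq (W j a) * (ρ.eig j * Real.logb 2 (s a)) := by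
    rw [Finset.sum_comm]
    refine Finset.sum_congr rfl fun a _ => ?_
    rw [diagIn_mat_eq, Finset.sum_mul]
    exact Finset.sum_congr rfl fun j _ => by ring
  have e3 : ∑ j, ∑ a, Complex.normSq (W j a) * ((ρ.eig j - s a) / Real.log 2) =
      (1 - ∑ a, s a) / Real.log 2 := by
    have : ∀ j a, Complex.normSq (W j a) * ((ρ.eig j - s a) / Real.log 2) =
      (Complex.normSq (W j a) * ρ.eig j - Complex.normSq (W j a) * s a) / Real.log 2 := by
      intros; ring
    simp only [this, ← Finset.sum_div, Finset.sum_sub_distrib]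
    congr 2
    · simp only [← Finset.sum_mul, sum_normSq_row hW, one_mul, sum_eig]
    · rw [Finset.sum_comm]
      simp only [← Finset.sum_mul, sum_normSq_col hW, one_mul]
  have e4 : 0 ≤ (1 - ∑ a, s a) / Real.log 2 :=
    div_nonneg (by linarith) (Real.log_pos one_lt_two).le
  have e5 : ∑ j, ∑ a, Complex.normSq (W j a) * ((ρ.eig j - s a) / Real.log 2) ≤
      ∑ j, ∑ a, Complex.normSq (W j a) * (ρ.eig j * (Real.logb 2 (ρ.eig j) - Real.logb 2 (s a))) :=
    Finset.sum_le_sum fun j _ => Finset.sum_le_sum fun a _ =>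
      mul_le_mul_of_nonneg_left (sub_le_mul_logb (ρ.eig_nonneg j) (hs a)) (Complex.normSq_nonneg _)
  simp only [mul_sub, Finset.sum_sub_distrib] at e5 e3
  rw [e1, e2]
  linarith

/-- Positive eigenvalues are needed because `Real.logb 2 0 = 0` makes `crossEntropy` finite where it
should be infinite. -/
lemma entropy_le_crossEntropy (ρ σ : DensityOperator ι) (hσ : ∀ a, 0 < σ.eig a) :
    ρ.entropy ≤ crossEntropy ρ σ :=
  entropy_le_of_basis ρ σ.basis_unitary hσ σ.sum_eig.le

lemma eig_mul_logb_nonpos (ρ : DensityOperator ι) (a : ι) :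
    ρ.eig a * Real.logb 2 (ρ.eig a) ≤ 0 :=
  mul_nonpos_of_nonneg_of_nonpos (ρ.eig_nonneg a)
    (Real.logb_nonpos one_lt_two (ρ.eig_nonneg a) (ρ.eig_le_one a))

lemma entropy_nonneg (ρ : DensityOperator ι) : 0 ≤ ρ.entropy := by
  rw [entropy_eq, neg_nonneg]
  exact Finset.sum_nonpos fun a _ => eig_mul_logb_nonpos ρ a

lemma nonempty_index (ρ : DensityOperator ι) : Nonempty ι := by
  by_contra h
  rw [not_nonempty_iff] at h
  have := ρ.sum_eig
  simp at this

lemma entropy_le_logb_card (ρ : DensityOperator ι) :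
    ρ.entropy ≤ Real.logb 2 (Fintype.card ι) := by
  have := ρ.nonempty_index
  have hd : 0 < (Fintype.card ι : ℝ) := by exact_mod_cast Fintype.card_pos
  have h := entropy_le_of_basis ρ ρ.basis_unitary (s := fun _ => (Fintype.card ι : ℝ)⁻¹)
    (fun _ => inv_pos.2 hd) (by simp [hd.ne'])
  simpa [← Finset.sum_mul, sum_diagIn_eq_one ρ ρ.basis_unitary] using h

lemma posDef_of_eig_pos {σ : DensityOperator ι} (hσ : ∀ a, 0 < σ.eig a) : σ.mat.PosDef :=
  σ.posSemidef.1.posDef_iff_eigenvalues_pos.2 hσ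

lemma crossEntropy_eq_trace (ρ σ : DensityOperator ι) :
    crossEntropy ρ σ =
      -(trace (diagMat σ.basis (fun a => Real.log (σ.eig a)) * ρ.mat)).re / Real.log 2 := by
  rw [trace_diagMat_mul, crossEntropy, neg_div, Finset.sum_div]
  congr 1
  refine Finset.sum_congr rfl fun a _ => ?_
  rw [Real.logb]
  ring

/-- Monotonicity of `σ ↦ -Tr (ρ log σ)`, from operator monotonicity of the logarithm. -/
lemma crossEntropy_le_of_le (ρ : DensityOperator ι) {σ τ : DensityOperator ι}
    (hσ : ∀ a, 0 < σ.eig a) (hτ : ∀ a, 0 < τ.eig a) {c : ℝ} (hc : 0 < c)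
    (h : (c • σ.mat - τ.mat).PosSemidef) :
    crossEntropy ρ σ ≤ crossEntropy ρ τ + Real.logb 2 c := by
  have h1 := diagMat_log_le (posDef_of_eig_pos hτ) (posDef_of_eig_pos hσ) hc h
  have h2 := trace_mul_re_nonneg h1 ρ.posSemidef
  rw [Matrix.sub_mul, Matrix.add_mul, trace_sub, trace_add, Complex.sub_re, Complex.add_re,
    Matrix.smul_mul, Matrix.one_mul, trace_smul, ρ.trace_eq_one] at h2
  have h3 : (Real.log c • (1 : ℂ)).re = Real.log c := by simp
  rw [h3] at h2
  rw [crossEntropy_eq_trace, crossEntropy_eq_trace, Real.logb, ← add_div]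
  refine div_le_div_of_nonneg_right ?_ (Real.log_pos one_lt_two).le
  change 0 ≤ (trace (diagMat σ.basis (fun a => Real.log (σ.eig a)) * ρ.mat)).re + Real.log c -
    (trace (diagMat τ.basis (fun a => Real.log (τ.eig a)) * ρ.mat)).re at h2
  linarith

end DensityOperator

/-! ### Independent random variables on a finite product -/

section Chebyshev

variable {n : ℕ} {κ : Fin n → Type*} [∀ i, Fintype (κ i)]

/-- Distributivity turns the sum over tuples into a product of sums; `Function.update` puts `g` in
slot `i` and 1 in every other slot, where the sum is 1. -/
lemma sum_prod_mul_coord {q : ∀ i, κ i → ℝ} (hq1 : ∀ i, ∑ a, q i a = 1) (i : Fin n) (g : κ i → ℝ) :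
    ∑ x : ∀ i, κ i, (∏ k, q k (x k)) * g (x i) = ∑ a, q i a * g a := by
  have h := Fintype.prod_sum (fun k a => q k a * Function.update (fun _ _ => (1 : ℝ)) i g k a)
  have h1 : ∏ k, ∑ a, q k a * Function.update (fun _ _ => (1 : ℝ)) i g k a =
      ∑ a, q i a * g a := by
    rw [Fintype.prod_eq_single i]
    · simp
    · intro k hk
      simp [hk, hq1]
  rw [← h1, h]
  refine Finset.sum_congr rfl fun x _ => ?_
  rw [Finset.prod_mul_distrib]
  congr 1
  rw [Fintype.prod_eq_single i]
  · simp
  · intro k hk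
    simp [hk]

lemma sum_prod_mul_coord_mul_coord {q : ∀ i, κ i → ℝ} (hq1 : ∀ i, ∑ a, q i a = 1) {i j : Fin n}
    (hij : i ≠ j) (g : κ i → ℝ) (h : κ j → ℝ) :
    ∑ x : ∀ i, κ i, (∏ k, q k (x k)) * (g (x i) * h (x j)) =
      (∑ a, q i a * g a) * ∑ a, q j a * h a := by
  have e := Fintype.prod_sum (fun k a => q k a *
    (Function.update (fun _ _ => (1 : ℝ)) i g k a * Function.update (fun _ _ => (1 : ℝ)) j h k a))
  have h1 : ∏ k, ∑ a, q k a * (Function.update (fun _ _ => (1 : ℝ)) i g k a *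
      Function.update (fun _ _ => (1 : ℝ)) j h k a) =
      (∑ a, q i a * g a) * ∑ a, q j a * h a := by
    rw [Fintype.prod_eq_mul i j hij]
    · simp [hij, hij.symm]
    · intro k hk
      simp [hk.1, hk.2, hq1]
  rw [← h1, e]
  refine Finset.sum_congr rfl fun x _ => ?_
  rw [Finset.prod_mul_distrib]
  congr 1
  rw [Fintype.prod_eq_mul i j hij]
  · simp [hij, hij.symm]
  · intro k hk
    simp [hk.1, hk.2]

lemma sum_prod_eq_one {q : ∀ i, κ i → ℝ} (hq1 : ∀ i, ∑ a, q i a = 1) :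
    ∑ x : ∀ i, κ i, ∏ k, q k (x k) = 1 := by
  rw [← Fintype.prod_sum]
  simp [hq1]

/-- Chebyshev's inequality for sums of independent random variables. -/
lemma chebyshev {q : ∀ i, κ i → ℝ} (hq : ∀ i a, 0 ≤ q i a) (hq1 : ∀ i, ∑ a, q i a = 1)
    (X : ∀ i, κ i → ℝ) {V : ℝ} (hV : ∀ i, ∑ a, q i a * X i a ^ 2 ≤ V) {t : ℝ} (ht : 0 < t)
    (G : Finset (∀ i, κ i))
    (hG : ∀ x ∈ G, t ≤ |∑ i, X i (x i) - ∑ i, ∑ a, q i a * X i a|) :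
    ∑ x ∈ G, ∏ k, q k (x k) ≤ n * V / t ^ 2 := by
  set m : Fin n → ℝ := fun i => ∑ a, q i a * X i a with hm
  set Y : ∀ i, κ i → ℝ := fun i a => X i a - m i with hY
  have hY0 : ∀ i, ∑ a, q i a * Y i a = 0 := by
    intro i
    simp [hY, mul_sub, Finset.sum_sub_distrib, ← Finset.sum_mul, hq1, hm]
  have hY2 : ∀ i, ∑ a, q i a * (Y i a * Y i a) ≤ V := by
    intro i
    have : ∀ a, q i a * (Y i a * Y i a) =
        q i a * X i a ^ 2 - 2 * m i * (q i a * X i a) + m i ^ 2 * q i a := by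
      intro a; simp only [hY]; ring
    simp only [this, Finset.sum_add_distrib, Finset.sum_sub_distrib, ← Finset.mul_sum, hq1]
    nlinarith [hV i, sq_nonneg (m i)]
  have hvar : ∑ x : ∀ i, κ i, (∏ k, q k (x k)) * (∑ i, Y i (x i)) ^ 2 ≤ n * V := by
    have e : ∀ x : ∀ i, κ i, (∏ k, q k (x k)) * (∑ i, Y i (x i)) ^ 2 =
        ∑ i, ∑ j, (∏ k, q k (x k)) * (Y i (x i) * Y j (x j)) := by
      intro x
      rw [sq, Finset.sum_mul_sum, Finset.mul_sum]
      simp only [Finset.mul_sum]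
    simp only [e]
    rw [Finset.sum_comm]
    calc ∑ i, ∑ x : ∀ i, κ i, ∑ j, (∏ k, q k (x k)) * (Y i (x i) * Y j (x j))
        = ∑ i, ∑ a, q i a * (Y i a * Y i a) := by
          refine Finset.sum_congr rfl fun i _ => ?_
          rw [Finset.sum_comm, Finset.sum_eq_single i]
          · exact sum_prod_mul_coord hq1 i (fun a => Y i a * Y i a)
          · intro j _ hj
            rw [sum_prod_mul_coord_mul_coord hq1 hj.symm, hY0, zero_mul]
          · simp
      _ ≤ ∑ _i : Fin n, V := Finset.sum_le_sum fun i _ => hY2 i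
      _ = n * V := by simp
  have hp : ∀ x : ∀ i, κ i, 0 ≤ ∏ k, q k (x k) := fun x => Finset.prod_nonneg fun k _ => hq k _
  rw [le_div_iff₀ (by positivity), Finset.sum_mul]
  refine le_trans (le_trans (Finset.sum_le_sum fun x hx => ?_)
    (Finset.sum_le_univ_sum_of_nonneg fun x => mul_nonneg (hp x) (sq_nonneg (∑ i, Y i (x i))))) hvar
  refine mul_le_mul_of_nonneg_left ?_ (hp x)
  have h1 := hG x hx
  rw [← Finset.sum_sub_distrib] at h1
  exact (pow_le_pow_left₀ ht.le h1 2).trans_eq (sq_abs _)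

end Chebyshev

/-! ### Tensor products of matrices and of states -/

section Tensor

variable {n : ℕ} {κ : Type*}

/-- The tensor product of a tuple of matrices. -/
def tens (A : Fin n → Matrix κ κ ℂ) : Matrix (Fin n → κ) (Fin n → κ) ℂ :=
  Matrix.of fun a b => ∏ i, A i (a i) (b i)

lemma tens_conjTranspose (A : Fin n → Matrix κ κ ℂ) : (tens A)ᴴ = tens fun i => (A i)ᴴ := by
  ext a b
  simp [tens, conjTranspose_apply]

lemma tens_diagonal [DecidableEq κ] (d : Fin n → κ → ℂ) :
    tens (fun i => diagonal (d i)) = diagonal fun a => ∏ i, d i (a i) := by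
  ext a b
  by_cases h : a = b
  · subst h
    simp [tens]
  · rw [diagonal_apply_ne _ h]
    obtain ⟨i, hi⟩ := Function.ne_iff.1 h
    exact Finset.prod_eq_zero (Finset.mem_univ i) (diagonal_apply_ne _ hi)

lemma tens_one [DecidableEq κ] : tens (fun _ : Fin n => (1 : Matrix κ κ ℂ)) = 1 := by
  have := tens_diagonal (fun (_ : Fin n) (_ : κ) => (1 : ℂ))
  simpa using this

/-- Multilinearity: the average of product states under a product distribution is the product of the
averages. -/
lemma sum_smul_tens {T : Fin n → Type*} [∀ i, Fintype (T i)] (p : ∀ i, T i → ℝ)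
    (A : ∀ i, T i → Matrix κ κ ℂ) :
    ∑ x : ∀ i, T i, (∏ i, p i (x i)) • tens (fun i => A i (x i)) =
      tens fun i => ∑ t, p i t • A i t := by
  ext a b
  simp only [tens, Matrix.sum_apply, Matrix.smul_apply, of_apply, Fintype.prod_sum]
  refine Finset.sum_congr rfl fun x _ => ?_
  simp [Finset.prod_mul_distrib]

variable [Fintype κ]

lemma tens_mul (A B : Fin n → Matrix κ κ ℂ) : tens A * tens B = tens fun i => A i * B i := by
  ext a b
  simp only [Matrix.mul_apply, tens, of_apply, Fintype.prod_sum, Finset.prod_mul_distrib]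

lemma trace_tens (A : Fin n → Matrix κ κ ℂ) : trace (tens A) = ∏ i, trace (A i) := by
  simp only [trace, diag_apply, tens, of_apply, Fintype.prod_sum]

lemma ofReal_diagIn {U E : Matrix κ κ ℂ} (hE : E.PosSemidef) (a : κ) :
    (diagIn U E a : ℂ) = (Uᴴ * E * U) a a :=
  Complex.ext rfl (Complex.le_def.1 (hE.conjTranspose_mul_mul_same U).diag_nonneg).2

variable [DecidableEq κ]

lemma tens_unitary {U : Fin n → Matrix κ κ ℂ} (hU : ∀ i, (U i)ᴴ * U i = 1) :
    (tens U)ᴴ * tens U = 1 := by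
  rw [tens_conjTranspose, tens_mul]
  simp only [hU, tens_one]

lemma tens_diagMat (U : Fin n → Matrix κ κ ℂ) (d : Fin n → κ → ℝ) :
    tens (fun i => diagMat (U i) (d i)) = diagMat (tens U) fun a => ∏ i, d i (a i) := by
  simp only [diagMat, ← tens_mul, tens_diagonal, tens_conjTranspose, Complex.ofReal_prod]

-- Positivity makes the diagonal entries real, so the real part of their product is the product of
-- their real parts.
omit [DecidableEq κ] in
lemma diagIn_tens {U A : Fin n → Matrix κ κ ℂ} (hA : ∀ i, (A i).PosSemidef) (a : Fin n → κ) :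
    diagIn (tens U) (tens A) a = ∏ i, diagIn (U i) (A i) (a i) := by
  rw [diagIn, tens_conjTranspose, tens_mul, tens_mul, tens, of_apply]
  simp only [← ofReal_diagIn (hA _), ← Complex.ofReal_prod, Complex.ofReal_re]

end Tensor

namespace DensityOperator

variable {ι : Type*} [Fintype ι] {n : ℕ}

lemma tensor_eq_tens (ρ : Fin n → DensityOperator ι) : tensor ρ = tens fun i => (ρ i).mat := rfl

variable [DecidableEq ι]

lemma tensor_eq_diagMat (ρ : Fin n → DensityOperator ι) :
    tensor ρ = diagMat (tens fun i => (ρ i).basis) fun a => ∏ i, (ρ i).eig (a i) := by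
  rw [tensor_eq_tens, ← tens_diagMat]
  simp only [← mat_eq]

lemma tensor_posSemidef (ρ : Fin n → DensityOperator ι) : (tensor ρ).PosSemidef := by
  rw [tensor_eq_diagMat]
  exact diagMat_posSemidef _ fun a => Finset.prod_nonneg fun i _ => eig_nonneg _ _

omit [DecidableEq ι] in
lemma trace_tensor (ρ : Fin n → DensityOperator ι) : trace (tensor ρ) = 1 := by
  rw [tensor_eq_tens, trace_tens]
  simp [trace_eq_one]

lemma tens_basis_unitary (ρ : Fin n → DensityOperator ι) :
    (tens fun i => (ρ i).basis)ᴴ * (tens fun i => (ρ i).basis) = 1 :=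
  tens_unitary fun i => (ρ i).basis_unitary

end DensityOperator

/-! ### Mixing with the maximally mixed state; measurability of the entropy -/

namespace DensityOperator

variable {ι : Type*} [Fintype ι]

lemma ext_mat {ρ σ : DensityOperator ι} (h : ρ.mat = σ.mat) : ρ = σ := by
  cases ρ; cases σ; cases h; rfl

/-- The convex combination `(1 - t) ρ + t σ`. -/
def mix (t : ℝ) (ht : t ∈ Set.Icc (0 : ℝ) 1) (ρ σ : DensityOperator ι) : DensityOperator ι where
  mat := (1 - t) • ρ.mat + t • σ.mat
  posSemidef := (ρ.posSemidef.smul (sub_nonneg.2 ht.2)).add (σ.posSemidef.smul ht.1)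
  trace_eq_one := by simp [trace_add, trace_smul, trace_eq_one]

variable [DecidableEq ι]

lemma crossEntropy_mix {t : ℝ} (ht : t ∈ Set.Icc (0 : ℝ) 1) (ρ σ τ : DensityOperator ι) :
    crossEntropy (mix t ht ρ σ) τ = (1 - t) * crossEntropy ρ τ + t * crossEntropy σ τ := by
  simp only [crossEntropy, mix, diagIn_add, diagIn_smul, mul_neg, ← neg_add, Finset.mul_sum,
    ← Finset.sum_add_distrib]
  congr 1
  exact Finset.sum_congr rfl fun a _ => by ring

/-- The maximally mixed state. -/
def maximallyMixed [Nonempty ι] : DensityOperator ι where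
  mat := (Fintype.card ι : ℝ)⁻¹ • 1
  posSemidef := PosSemidef.one.smul (by positivity)
  trace_eq_one := by
    rw [trace_smul, trace_one, Complex.real_smul]
    push_cast
    exact inv_mul_cancel₀ (by exact_mod_cast Fintype.card_ne_zero)

variable [Nonempty ι] {k : ℝ}

/-- The state `(1 - k) ρ + k 𝟙/d`. -/
def smooth (k : ℝ) (hk : k ∈ Set.Icc (0 : ℝ) 1) (ρ : DensityOperator ι) : DensityOperator ι :=
  mix k hk ρ maximallyMixed

lemma diagIn_smooth (hk : k ∈ Set.Icc (0 : ℝ) 1) (ρ : DensityOperator ι) {U : Matrix ι ι ℂ}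
    (hU : Uᴴ * U = 1) (a : ι) :
    diagIn U (smooth k hk ρ).mat a = (1 - k) * diagIn U ρ.mat a + k / Fintype.card ι := by
  simp only [smooth, mix, maximallyMixed, diagIn_add, diagIn_smul, diagIn_one hU]
  ring

lemma eig_smooth_ge (hk : k ∈ Set.Icc (0 : ℝ) 1) (ρ : DensityOperator ι) (a : ι) :
    k / Fintype.card ι ≤ (smooth k hk ρ).eig a := by
  rw [← diagIn_basis, diagIn_smooth hk ρ (basis_unitary _)]
  have := mul_nonneg (sub_nonneg.2 hk.2) (diagIn_nonneg (U := (smooth k hk ρ).basis) ρ.posSemidef a)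
  linarith

omit [DecidableEq ι] in
lemma card_pos' : 0 < (Fintype.card ι : ℝ) := by exact_mod_cast Fintype.card_pos

lemma eig_smooth_pos (hk : k ∈ Set.Icc (0 : ℝ) 1) (hk0 : 0 < k) (ρ : DensityOperator ι) (a : ι) :
    0 < (smooth k hk ρ).eig a :=
  (div_pos hk0 card_pos').trans_le (eig_smooth_ge hk ρ a)

/-- A smoothed eigenvalue is at least `1 - k` times the original one, so its logarithm drops by at
most `-logb 2 (1 - k)`. -/
lemma neg_sum_eig_mul_logb_le (hk0 : 0 < k) (hk1 : k < 1) (ρ : DensityOperator ι) :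
    -∑ a, ρ.eig a * Real.logb 2 ((1 - k) * ρ.eig a + k / Fintype.card ι) ≤
      ρ.entropy - Real.logb 2 (1 - k) := by
  have h : ∀ a, ρ.eig a * Real.logb 2 (1 - k) + ρ.eig a * Real.logb 2 (ρ.eig a) ≤
      ρ.eig a * Real.logb 2 ((1 - k) * ρ.eig a + k / Fintype.card ι) := by
    intro a
    rcases (ρ.eig_nonneg a).eq_or_lt with h0 | h0
    · simp [← h0]
    · rw [← mul_add, ← Real.logb_mul (by linarith) h0.ne']
      refine mul_le_mul_of_nonneg_left ?_ h0.le
      have : 0 < k / Fintype.card ι := div_pos hk0 card_pos'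
      exact Real.logb_le_logb_of_le one_lt_two (mul_pos (by linarith) h0) (by linarith)
  have h2 := Finset.sum_le_sum fun a (_ : a ∈ Finset.univ) => h a
  rw [Finset.sum_add_distrib, ← Finset.sum_mul, sum_eig, one_mul] at h2
  rw [entropy_eq]
  linarith

/-- The bound on the increase of entropy in `entropy_smooth_le`. -/
def smoothError (ι : Type*) [Fintype ι] (k : ℝ) : ℝ :=
  -((1 - k) * Real.logb 2 (1 - k)) + (k * Real.logb 2 (Fintype.card ι) - k * Real.logb 2 k)

lemma sum_smooth_eig (k : ℝ) (ρ : DensityOperator ι) :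
    ∑ a, ((1 - k) * ρ.eig a + k / Fintype.card ι) = 1 := by
  rw [Finset.sum_add_distrib, ← Finset.mul_sum, sum_eig]
  have := (card_pos' (ι := ι)).ne'
  simp
  field_simp
  ring

/-- Klein's inequality in the eigenbasis of `ρ` against the smoothed eigenvalues: the previous
estimate handles the share of `ρ`, the lower bound `k / card ι` the uniform share. -/
lemma entropy_smooth_le (hk : k ∈ Set.Icc (0 : ℝ) 1) (hk0 : 0 < k) (hk1 : k < 1)
    (ρ : DensityOperator ι) :
    (smooth k hk ρ).entropy ≤ (1 - k) * ρ.entropy + smoothError ι k := by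
  have hd := card_pos' (ι := ι)
  have hkd : 0 < k / Fintype.card ι := div_pos hk0 hd
  have hpos : ∀ a, 0 ≤ (1 - k) * ρ.eig a := fun a =>
    mul_nonneg (by linarith) (ρ.eig_nonneg a)
  have h1 := entropy_le_of_basis (smooth k hk ρ) ρ.basis_unitary
    (s := fun a => (1 - k) * ρ.eig a + k / Fintype.card ι)
    (fun a => by linarith [hpos a]) (sum_smooth_eig k ρ).le
  simp only [diagIn_smooth hk ρ ρ.basis_unitary, diagIn_basis, add_mul, Finset.sum_add_distrib,
    mul_assoc, ← Finset.mul_sum] at h1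
  have h2 := mul_le_mul_of_nonneg_left (neg_sum_eig_mul_logb_le hk0 hk1 ρ)
    (sub_nonneg.2 hk1.le)
  have h3 : Fintype.card ι * Real.logb 2 (k / Fintype.card ι) ≤
      ∑ a, Real.logb 2 ((1 - k) * ρ.eig a + k / Fintype.card ι) := by
    have := Finset.sum_le_sum fun a (_ : a ∈ Finset.univ) =>
      Real.logb_le_logb_of_le one_lt_two hkd (by linarith [hpos a] :
        k / Fintype.card ι ≤ (1 - k) * ρ.eig a + k / Fintype.card ι)
    simpa using this
  have h4 := mul_le_mul_of_nonneg_left h3 hkd.le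
  rw [Real.logb_div hk0.ne' hd.ne', ← mul_assoc, div_mul_cancel₀ _ hd.ne'] at h4
  simp only [smoothError]
  linarith

omit [DecidableEq ι] [Nonempty ι] in
lemma smoothError_tendsto : Tendsto (smoothError ι) (𝓝 0) (𝓝 0) := by
  have hc : Continuous fun x : ℝ => x * Real.logb 2 x := by
    simp only [Real.logb, ← mul_div_assoc]
    exact Real.continuous_mul_log.div_const _
  have : Continuous (smoothError ι) := by
    have h1 : Continuous fun k : ℝ => (1 - k) * Real.logb 2 (1 - k) :=
      hc.comp (continuous_const.sub continuous_id)
    exact h1.neg.add ((continuous_id.mul continuous_const).sub hc)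
  have h := this.tendsto 0
  simpa [smoothError] using h

omit [DecidableEq ι] [Nonempty ι] in
lemma continuous_diagIn (U : Matrix ι ι ℂ) (a : ι) :
    Continuous fun ρ : DensityOperator ι => diagIn U ρ.mat a := by
  have h : Continuous fun ρ : DensityOperator ι => ρ.mat := continuous_induced_dom
  exact Complex.continuous_re.comp
    (((continuous_const.matrix_mul h).matrix_mul continuous_const).matrix_elem a a)

-- Entropy is upper semicontinuous: by Klein's inequality it lies below continuous affine functions,
-- and near a given `ρ` smoothing its eigenvalues yields such a function with value at `ρ` as close
-- to `ρ.entropy` as desired.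
omit [Nonempty ι] in
lemma measurable_entropy : Measurable fun ρ : DensityOperator ι => ρ.entropy := by
  refine measurable_of_Iio fun y => IsOpen.measurableSet ?_
  rw [isOpen_iff_mem_nhds]
  intro ρ hρ
  have hne : Nonempty ι := ρ.nonempty_index
  have hlim : Tendsto (fun k : ℝ => ρ.entropy - Real.logb 2 (1 - k)) (𝓝[>] 0) (𝓝 ρ.entropy) := by
    have : ContinuousAt (fun k : ℝ => ρ.entropy - Real.logb 2 (1 - k)) 0 := by
      have : ContinuousAt (fun k : ℝ => Real.log (1 - k)) 0 :=
        (continuousAt_const.sub continuousAt_id).log (by simp)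
      exact continuousAt_const.sub (this.div_const _)
    have h := this.tendsto
    simp only [sub_zero, Real.logb_one] at h
    exact h.mono_left nhdsWithin_le_nhds
  obtain ⟨k, hk, hk1, hk0⟩ := ((hlim.eventually_lt_const hρ).and
    ((eventually_lt_nhds (zero_lt_one' ℝ)).filter_mono nhdsWithin_le_nhds |>.and
      self_mem_nhdsWithin)).exists
  have hk0 : 0 < k := hk0
  set s : ι → ℝ := fun a => (1 - k) * ρ.eig a + k / Fintype.card ι with hs
  have hcont : Continuous fun τ : DensityOperator ι =>
      -∑ a, diagIn ρ.basis τ.mat a * Real.logb 2 (s a) :=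
    (continuous_finsetSum _ fun a _ => (continuous_diagIn _ a).mul continuous_const).neg
  have hlt : -∑ a, diagIn ρ.basis ρ.mat a * Real.logb 2 (s a) < y := by
    simp only [diagIn_basis]
    exact (neg_sum_eig_mul_logb_le hk0 hk1 ρ).trans_lt hk
  filter_upwards [hcont.continuousAt.eventually_lt_const hlt] with τ hτ
  refine (entropy_le_of_basis τ ρ.basis_unitary (fun a => ?_) (sum_smooth_eig k ρ).le).trans_lt hτ
  have := div_pos hk0 (card_pos' (ι := ι))
  have := mul_nonneg (sub_nonneg.2 hk1.le) (ρ.eig_nonneg a)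
  linarith

omit [Nonempty ι] in
lemma integrable_entropy (P : ProbabilityMeasure (DensityOperator ι)) :
    Integrable (fun ρ : DensityOperator ι => ρ.entropy) (P : Measure (DensityOperator ι)) :=
  Integrable.of_bound measurable_entropy.aestronglyMeasurable (Real.logb 2 (Fintype.card ι))
    (Eventually.of_forall fun ρ => by
      rw [Real.norm_of_nonneg ρ.entropy_nonneg]
      exact ρ.entropy_le_logb_card)

end DensityOperator

end QChannel

/-! ### Finite ensembles, capacity and the divergence centre -/

namespace QChannel

open Matrix DensityOperator

variable {ι : Type*} [Fintype ι] [DecidableEq ι]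

/-- The pairs `(∑ pₓ ρₓ, ∑ pₓ H(ρₓ))` for finite ensembles `(pₓ, ρₓ)` of states in `𝒲`. -/
def ensembles (𝒲 : Set (DensityOperator ι)) : Set (Matrix ι ι ℂ × ℝ) :=
  convexHull ℝ ((fun ρ : DensityOperator ι => (ρ.mat, ρ.entropy)) '' 𝒲)

lemma mem_ensembles {𝒲 : Set (DensityOperator ι)} {ρ : DensityOperator ι} (h : ρ ∈ 𝒲) :
    (ρ.mat, ρ.entropy) ∈ ensembles 𝒲 :=
  subset_convexHull ℝ _ ⟨ρ, h, rfl⟩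

lemma mix_mem_ensembles {𝒲 : Set (DensityOperator ι)} {ρ σ : DensityOperator ι} {g h t : ℝ}
    (ht : t ∈ Set.Icc (0 : ℝ) 1) (hρ : (ρ.mat, g) ∈ ensembles 𝒲) (hσ : (σ.mat, h) ∈ ensembles 𝒲) :
    ((mix t ht ρ σ).mat, (1 - t) * g + t * h) ∈ ensembles 𝒲 :=
  (convex_convexHull ℝ _) hρ hσ (sub_nonneg.2 ht.2) ht.1 (sub_add_cancel 1 t)

/-- The average state and the average entropy are both affine in the measure. -/
lemma convex_integral_pairs (𝒲 : Set (DensityOperator ι)) :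
    Convex ℝ {p : Matrix ι ι ℂ × ℝ | ∃ P : ProbabilityMeasure (DensityOperator ι),
      (P : Measure (DensityOperator ι)) 𝒲ᶜ = 0 ∧ (mean P).mat = p.1 ∧
      ∫ ρ, ρ.entropy ∂(P : Measure (DensityOperator ι)) = p.2} := by
  rintro ⟨A, g⟩ ⟨P, hP, hPA, hPg⟩ ⟨B, h⟩ ⟨Q, hQ, hQB, hQh⟩ a b ha hb hab
  have hprob : IsProbabilityMeasure (ENNReal.ofReal a • (P : Measure (DensityOperator ι)) +
      ENNReal.ofReal b • (Q : Measure (DensityOperator ι))) := by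
    constructor
    simp [← ENNReal.ofReal_add ha hb, hab]
  have hint : ∀ {E : Type} [NormedAddCommGroup E] [NormedSpace ℝ E] (f : DensityOperator ι → E),
      Integrable f (P : Measure (DensityOperator ι)) →
      Integrable f (Q : Measure (DensityOperator ι)) →
      ∫ ρ, f ρ ∂(ENNReal.ofReal a • (P : Measure (DensityOperator ι)) +
        ENNReal.ofReal b • (Q : Measure (DensityOperator ι))) =
      a • ∫ ρ, f ρ ∂(P : Measure (DensityOperator ι)) +
        b • ∫ ρ, f ρ ∂(Q : Measure (DensityOperator ι)) := by
    intro E _ _ f hf hg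
    rw [integral_add_measure (hf.smul_measure ENNReal.ofReal_ne_top)
      (hg.smul_measure ENNReal.ofReal_ne_top), integral_smul_measure, integral_smul_measure,
      ENNReal.toReal_ofReal ha, ENNReal.toReal_ofReal hb]
  refine ⟨⟨_, hprob⟩, ?_, ?_, ?_⟩
  · simp [hP, hQ]
  · ext i j
    have h1 := congrFun (congrFun hPA i) j
    have h2 := congrFun (congrFun hQB i) j
    simp only [mean, of_apply] at h1 h2
    simp only [mean, of_apply, ProbabilityMeasure.coe_mk]
    rw [hint _ (integrable_entry P i j) (integrable_entry Q i j), h1, h2]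
    simp
  · simp only [ProbabilityMeasure.coe_mk]
    rw [hint _ (integrable_entropy P) (integrable_entropy Q), hPg, hQh]
    simp

/-- Dirac measures give the generators of the convex hull, and convexity gives the rest. -/
lemma ensembles_subset_integral_pairs {𝒲 : Set (DensityOperator ι)} (h𝒲 : MeasurableSet 𝒲) :
    ensembles 𝒲 ⊆ {p | ∃ P : ProbabilityMeasure (DensityOperator ι),
      (P : Measure (DensityOperator ι)) 𝒲ᶜ = 0 ∧ (mean P).mat = p.1 ∧
      ∫ ρ, ρ.entropy ∂(P : Measure (DensityOperator ι)) = p.2} := by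
  refine convexHull_min ?_ (convex_integral_pairs 𝒲)
  rintro _ ⟨ρ, hρ, rfl⟩
  refine ⟨⟨Measure.dirac ρ, inferInstance⟩, ?_, ?_, ?_⟩
  · simp only [ProbabilityMeasure.coe_mk]
    rw [Measure.dirac_apply' _ h𝒲.compl]
    simp [hρ]
  · ext i j
    simp only [mean, of_apply, ProbabilityMeasure.coe_mk]
    exact integral_dirac' _ _ (continuous_entry i j).measurable.stronglyMeasurable
  · exact integral_dirac' _ _ measurable_entropy.stronglyMeasurable

lemma ensemble_mem_informationValues {𝒲 : Set (DensityOperator ι)} (h𝒲 : MeasurableSet 𝒲)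
    {τ : DensityOperator ι} {h : ℝ} (hτ : (τ.mat, h) ∈ ensembles 𝒲) :
    τ.entropy - h ∈ informationValues 𝒲 := by
  obtain ⟨P, hP, h1, h2⟩ := ensembles_subset_integral_pairs h𝒲 hτ
  refine ⟨P, hP, ?_⟩
  rw [holevoInformation, h2, ext_mat h1]

lemma informationValues_le {𝒲 : Set (DensityOperator ι)} {x : ℝ} (hx : x ∈ informationValues 𝒲) :
    x ≤ Real.logb 2 (Fintype.card ι) := by
  obtain ⟨P, -, rfl⟩ := hx
  have h1 := (mean P).entropy_le_logb_card
  have h2 : 0 ≤ ∫ ρ, ρ.entropy ∂(P : Measure (DensityOperator ι)) :=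
    integral_nonneg fun ρ => ρ.entropy_nonneg
  rw [holevoInformation]
  linarith

lemma bddAbove_informationValues (𝒲 : Set (DensityOperator ι)) :
    BddAbove (informationValues 𝒲) :=
  ⟨_, fun _ hx => informationValues_le hx⟩

lemma informationValues_nonempty {𝒲 : Set (DensityOperator ι)} (h𝒲 : MeasurableSet 𝒲)
    (hne : 𝒲.Nonempty) : (informationValues 𝒲).Nonempty :=
  let ⟨_, hρ⟩ := hne
  ⟨_, ensemble_mem_informationValues h𝒲 (mem_ensembles hρ)⟩

lemma isLUB_capacity {𝒲 : Set (DensityOperator ι)} (h𝒲 : MeasurableSet 𝒲) (hne : 𝒲.Nonempty) :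
    IsLUB (informationValues 𝒲) (capacity 𝒲) :=
  isLUB_csSup (informationValues_nonempty h𝒲 hne) (bddAbove_informationValues 𝒲)

omit [DecidableEq ι] in
lemma integral_diagIn (P : ProbabilityMeasure (DensityOperator ι)) (U : Matrix ι ι ℂ) (a : ι) :
    Integrable (fun ρ : DensityOperator ι => diagIn U ρ.mat a)
      (P : Measure (DensityOperator ι)) ∧
    ∫ ρ, diagIn U ρ.mat a ∂(P : Measure (DensityOperator ι)) = diagIn U (mean P).mat a := by
  have e : ∀ E : Matrix ι ι ℂ, diagIn U E a = (∑ b, (∑ c, Uᴴ a c * E c b) * U b a).re := by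
    intro E
    simp [diagIn, Matrix.mul_apply]
  have hi : ∀ b, Integrable (fun ρ : DensityOperator ι => ∑ c, Uᴴ a c * ρ.mat c b)
      (P : Measure (DensityOperator ι)) :=
    fun b => integrable_finsetSum _ fun c _ => (integrable_entry P c b).const_mul _
  have hi2 : Integrable (fun ρ : DensityOperator ι => ∑ b, (∑ c, Uᴴ a c * ρ.mat c b) * U b a)
      (P : Measure (DensityOperator ι)) :=
    integrable_finsetSum _ fun b _ => (hi b).mul_const _
  simp only [e]
  refine ⟨hi2.re, ?_⟩
  have h := integral_re (𝕜 := ℂ) hi2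
  refine h.trans ?_
  rw [integral_finsetSum _ fun b _ => (hi b).mul_const _]
  simp only [integral_mul_const]
  refine congrArg Complex.re (Finset.sum_congr rfl fun b _ => ?_)
  rw [integral_finsetSum _ fun c _ => (integrable_entry P c b).const_mul _]
  simp only [integral_const_mul, mean, of_apply]

lemma integral_crossEntropy (P : ProbabilityMeasure (DensityOperator ι)) (σ : DensityOperator ι) :
    Integrable (fun ρ => crossEntropy ρ σ) (P : Measure (DensityOperator ι)) ∧
    ∫ ρ, crossEntropy ρ σ ∂(P : Measure (DensityOperator ι)) = crossEntropy (mean P) σ := by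
  have hi : ∀ a, Integrable (fun ρ : DensityOperator ι =>
      diagIn σ.basis ρ.mat a * Real.logb 2 (σ.eig a)) (P : Measure (DensityOperator ι)) :=
    fun a => (integral_diagIn P _ a).1.mul_const _
  simp only [crossEntropy]
  refine ⟨(integrable_finsetSum _ fun a _ => hi a).neg, ?_⟩
  rw [integral_neg, integral_finsetSum _ fun a _ => hi a]
  simp only [integral_mul_const, (integral_diagIn P _ _).2]

/-- Since `crossEntropy` is affine in its first argument, Klein's inequality for the mean state
bounds the information by the average divergence from `σ`. -/
lemma holevoInformation_le {𝒲 : Set (DensityOperator ι)} {σ : DensityOperator ι}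
    (hσ : ∀ a, 0 < σ.eig a) {R : ℝ} (hR : ∀ ρ ∈ 𝒲, crossEntropy ρ σ - ρ.entropy ≤ R)
    {P : ProbabilityMeasure (DensityOperator ι)}
    (hP : (P : Measure (DensityOperator ι)) 𝒲ᶜ = 0) : holevoInformation P ≤ R := by
  have h1 := entropy_le_crossEntropy (mean P) σ hσ
  obtain ⟨hi, he⟩ := integral_crossEntropy P σ
  have hae : ∀ᵐ ρ ∂(P : Measure (DensityOperator ι)), crossEntropy ρ σ - ρ.entropy ≤ R := by
    have : ∀ᵐ ρ ∂(P : Measure (DensityOperator ι)), ρ ∈ 𝒲 := hP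
    filter_upwards [this] with ρ hρ using hR ρ hρ
  have h2 := integral_mono_ae (hi.sub (integrable_entropy P)) (integrable_const R) hae
  simp only [Pi.sub_apply] at h2
  rw [integral_sub hi (integrable_entropy P), he] at h2
  simp only [integral_const, probReal_univ, one_smul] at h2
  rw [holevoInformation]
  linarith

/-- The values `H(∑ pₓ ρₓ) - ∑ pₓ H(ρₓ)` for finite ensembles `(pₓ, ρₓ)` of states in `𝒲`. -/
def ensembleValues (𝒲 : Set (DensityOperator ι)) : Set ℝ :=
  {x | ∃ (τ : DensityOperator ι) (h : ℝ), (τ.mat, h) ∈ ensembles 𝒲 ∧ x = τ.entropy - h}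

lemma one_sub_mat_posSemidef (ρ : DensityOperator ι) : (1 - ρ.mat).PosSemidef := by
  rw [mat_eq ρ, ← diagMat_one ρ.basis_unitary, ← diagMat_sub]
  exact diagMat_posSemidef _ fun a => sub_nonneg.2 (ρ.eig_le_one a)

/-- Every state is at most 1, which is at most `card ι / k` times a smoothed state. So a small step
`t` changes the smoothed state by a factor near 1 in operator order, and the logarithm is operator
monotone. -/
lemma crossEntropy_smooth_le [Nonempty ι] {k t : ℝ} (hk : k ∈ Set.Icc (0 : ℝ) 1) (hk0 : 0 < k)
    (ht : t ∈ Set.Icc (0 : ℝ) 1) (ρ τ υ : DensityOperator ι) :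
    crossEntropy ρ (smooth k hk τ) ≤ crossEntropy ρ (smooth k hk (mix t ht τ υ)) +
      Real.logb 2 (1 - t + t * (Fintype.card ι / k)) := by
  have hd := card_pos' (ι := ι)
  have hdk : 1 ≤ (Fintype.card ι : ℝ) / k := by
    rw [one_le_div hk0]
    exact hk.2.trans (by exact_mod_cast Fintype.card_pos)
  refine crossEntropy_le_of_le ρ (eig_smooth_pos hk hk0 _) (eig_smooth_pos hk hk0 _) ?_ ?_
  · nlinarith [ht.1, ht.2]
  · have e : (1 - t + t * (Fintype.card ι / k)) • (smooth k hk τ).mat -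
        (smooth k hk (mix t ht τ υ)).mat =
        (t * (Fintype.card ι / k) * (1 - k)) • τ.mat + t • (1 - (smooth k hk υ).mat) := by
      simp only [smooth, mix, maximallyMixed]
      have h1 : (Fintype.card ι / k) * k * (Fintype.card ι : ℝ)⁻¹ = 1 := by field_simp
      have h2 : t • (1 : Matrix ι ι ℂ) =
          (t * ((Fintype.card ι / k) * k * (Fintype.card ι : ℝ)⁻¹)) • (1 : Matrix ι ι ℂ) := by
        rw [h1, mul_one]
      rw [smul_sub, h2]
      module
    rw [e]
    exact (τ.posSemidef.smul (mul_nonneg (mul_nonneg ht.1 (by positivity))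
      (sub_nonneg.2 hk.2))).add ((one_sub_mat_posSemidef _).smul ht.1)

lemma le_crossEntropy_smooth [Nonempty ι] {k : ℝ} (hk : k ∈ Set.Icc (0 : ℝ) 1)
    (ρ σ : DensityOperator ι) :
    (1 - k) * crossEntropy ρ σ ≤ crossEntropy (smooth k hk ρ) σ := by
  rw [smooth, crossEntropy_mix]
  have : 0 ≤ crossEntropy maximallyMixed σ := by
    rw [crossEntropy, neg_nonneg]
    exact Finset.sum_nonpos fun a _ => mul_nonpos_of_nonneg_of_nonpos
      (diagIn_nonneg maximallyMixed.posSemidef a)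
      (Real.logb_nonpos one_lt_two (σ.eig_nonneg a) (σ.eig_le_one a))
  have := mul_nonneg hk.1 this
  linarith

lemma mix_smooth_smooth [Nonempty ι] {k t : ℝ} (hk : k ∈ Set.Icc (0 : ℝ) 1)
    (ht : t ∈ Set.Icc (0 : ℝ) 1) (ρ σ : DensityOperator ι) :
    smooth k hk (mix t ht ρ σ) = mix t ht (smooth k hk ρ) (smooth k hk σ) := by
  refine ext_mat ?_
  simp only [smooth, mix]
  module

/-- A state whose divergence from all states of `𝒲` is almost bounded by the capacity, with
eigenvalues bounded below uniformly in `𝒲`. -/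
lemma exists_divergence_center [Nonempty ι] {ε : ℝ} (hε : 0 < ε) :
    ∃ c : ℝ, 0 < c ∧ ∀ 𝒲 : Set (DensityOperator ι), 𝒲.Nonempty → ∀ C : ℝ,
      C ∈ upperBounds (ensembleValues 𝒲) →
      ∃ σ : DensityOperator ι, (∀ a, c ≤ σ.eig a) ∧
        ∀ ρ ∈ 𝒲, crossEntropy ρ σ - ρ.entropy ≤ C + ε := by
  have hd := card_pos' (ι := ι)
  -- Both `k` and the later `t` depend only on `ε` and the dimension, hence so does the eigenvalue
  -- bound `k / card ι`.
  obtain ⟨k, hke, hk2, hk0⟩ := ((((smoothError_tendsto (ι := ι)).eventually_lt_const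
    (show (0 : ℝ) < ε / 8 by linarith)).filter_mono (nhdsWithin_le_nhds (s := Set.Ioi 0))).and
    (((eventually_lt_nhds (show (0 : ℝ) < 1 / 2 by norm_num)).filter_mono nhdsWithin_le_nhds).and
      self_mem_nhdsWithin)).exists
  have hk0 : 0 < k := hk0
  have hk : k ∈ Set.Icc (0 : ℝ) 1 := ⟨hk0.le, by linarith⟩
  have hlim : Tendsto (fun t : ℝ => Real.logb 2 (1 - t + t * (Fintype.card ι / k)))
      (𝓝 0) (𝓝 0) := by
    have : ContinuousAt (fun t : ℝ => Real.log (1 - t + t * (Fintype.card ι / k))) 0 :=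
      ((continuousAt_const.sub continuousAt_id).add
        (continuousAt_id.mul continuousAt_const)).log (by simp)
    have h := (this.div_const (Real.log 2)).tendsto
    simpa [Real.logb] using h
  obtain ⟨t, hte, ht1, ht0⟩ := (((hlim.eventually_lt_const
    (show (0 : ℝ) < ε / 2 by linarith)).filter_mono (nhdsWithin_le_nhds (s := Set.Ioi 0))).and
    (((eventually_lt_nhds (zero_lt_one' ℝ)).filter_mono nhdsWithin_le_nhds).and
      self_mem_nhdsWithin)).exists
  have ht0 : 0 < t := ht0
  have ht : t ∈ Set.Icc (0 : ℝ) 1 := ⟨ht0.le, ht1.le⟩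
  refine ⟨k / Fintype.card ι, div_pos hk0 hd, fun 𝒲 hne C hC => ?_⟩
  set S : Set ℝ := {x | ∃ (τ : DensityOperator ι) (h : ℝ), (τ.mat, h) ∈ ensembles 𝒲 ∧
    x = (smooth k hk τ).entropy - (1 - k) * h} with hS
  have hSle : ∀ x ∈ S, x ≤ (1 - k) * C + ε / 8 := by
    rintro x ⟨τ, h, hτ, rfl⟩
    have h1 := entropy_smooth_le hk hk0 (by linarith) τ
    have h2 := mul_le_mul_of_nonneg_left (hC ⟨τ, h, hτ, rfl⟩) (sub_nonneg.2 hk.2)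
    linarith
  have hSb : BddAbove S := ⟨_, hSle⟩
  have hSne : S.Nonempty := let ⟨ρ, hρ⟩ := hne; ⟨_, ρ, _, mem_ensembles hρ, rfl⟩
  -- The centre is a near-maximizer of the smoothed functional. Its gap is proportional to `t` so
  -- that it survives division by `t` in the first-order comparison with a step towards `ρ`; no
  -- compactness is needed.
  obtain ⟨_, ⟨τ, h, hτ, rfl⟩, hnear⟩ := exists_lt_of_lt_csSup hSne
    (sub_lt_self (sSup S) (show 0 < t * (ε / 8) by positivity))
  refine ⟨smooth k hk τ, eig_smooth_ge hk τ, fun ρ hρ => ?_⟩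
  have h1 := le_csSup hSb ⟨_, _, mix_mem_ensembles ht hτ (mem_ensembles hρ), rfl⟩
  -- The entropy of `υ` splits into two cross entropies relative to `υ`; Klein's inequality bounds
  -- the first below, and the second contains the divergence of `ρ`.
  set υ := smooth k hk (mix t ht τ ρ) with hυ
  have h2 : υ.entropy = (1 - t) * crossEntropy (smooth k hk τ) υ +
      t * crossEntropy (smooth k hk ρ) υ := by
    rw [← crossEntropy_mix ht, ← mix_smooth_smooth hk ht, ← hυ, crossEntropy_self]
  have h3 := mul_le_mul_of_nonneg_left (entropy_le_crossEntropy (smooth k hk τ) υ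
    (eig_smooth_pos hk hk0 _)) (sub_nonneg.2 ht.2)
  have h4 := mul_le_mul_of_nonneg_left (le_crossEntropy_smooth hk ρ υ) ht0.le
  have h5 : t * ((1 - k) * (crossEntropy ρ υ - ρ.entropy)) ≤
      t * ((1 - k) * C + ε / 4) := by
    have := mul_le_mul_of_nonneg_left (hSle _ ⟨τ, h, hτ, rfl⟩) ht0.le
    linarith
  have h6 := le_of_mul_le_mul_left h5 ht0
  -- Here `k < 1 / 2` gives `ε / 4 ≤ (1 - k) * (ε / 2)`.
  have h7 : (1 - k) * (crossEntropy ρ υ - ρ.entropy) ≤ (1 - k) * (C + ε / 2) := by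
    nlinarith
  have h8 := le_of_mul_le_mul_left h7 (by linarith)
  have h9 := crossEntropy_smooth_le hk hk0 ht ρ τ ρ
  linarith

lemma capacity_mem_upperBounds_ensembleValues {𝒲 : Set (DensityOperator ι)}
    (h𝒲 : MeasurableSet 𝒲) : capacity 𝒲 ∈ upperBounds (ensembleValues 𝒲) := by
  rintro _ ⟨τ, h, hτ, rfl⟩
  exact le_csSup (bddAbove_informationValues 𝒲) (ensemble_mem_informationValues h𝒲 hτ)

/-- If finite ensembles stayed below `capacity 𝒲 - ε`, a divergence centre for that smaller bound
would keep every Borel distribution below `capacity 𝒲 - ε / 2`. -/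
lemma exists_ensemble_near_capacity {𝒲 : Set (DensityOperator ι)} (h𝒲 : MeasurableSet 𝒲)
    (hne : 𝒲.Nonempty) {ε : ℝ} (hε : 0 < ε) :
    ∃ (τ : DensityOperator ι) (h : ℝ), (τ.mat, h) ∈ ensembles 𝒲 ∧
      capacity 𝒲 - ε < τ.entropy - h := by
  have : Nonempty ι := hne.some.nonempty_index
  by_contra! hcon
  have hub : capacity 𝒲 - ε ∈ upperBounds (ensembleValues 𝒲) := by
    rintro _ ⟨τ, h, hτ, rfl⟩
    exact hcon τ h hτ
  obtain ⟨c, hc, H⟩ := exists_divergence_center (ι := ι) (half_pos hε)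
  obtain ⟨σ, hσ, hσ2⟩ := H 𝒲 hne _ hub
  have : capacity 𝒲 ≤ capacity 𝒲 - ε + ε / 2 := by
    refine csSup_le (informationValues_nonempty h𝒲 hne) ?_
    rintro _ ⟨P, hP, rfl⟩
    exact holevoInformation_le (fun a => hc.trans_le (hσ a)) hσ2 hP
  linarith

end QChannel

/-! ### Typical eigenvectors, pinching and hypothesis testing -/

namespace QChannel

open Matrix DensityOperator

section Typical

variable {ι : Type*} [Fintype ι] [DecidableEq ι] {n : ℕ}

namespace DensityOperator

/-- A bound on `∑ r (log r)²` over the eigenvalues `r` of a state. -/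
def varianceBound (ι : Type*) [Fintype ι] : ℝ := Fintype.card ι * (4 / Real.log 2 ^ 2)

/-- Square the bound `|x log x| < 1` at `x = √r`; the factor 4 comes from `log √r = log r / 2`. -/
lemma mul_logb_sq_le {r : ℝ} (h0 : 0 ≤ r) (h1 : r ≤ 1) :
    r * Real.logb 2 r ^ 2 ≤ 4 / Real.log 2 ^ 2 := by
  have h2 : 0 < Real.log 2 := Real.log_pos one_lt_two
  rw [Real.logb, div_pow, mul_div_assoc']
  refine div_le_div_of_nonneg_right ?_ (by positivity)
  rcases h0.eq_or_lt with rfl | h0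
  · simp
  · have h := Real.abs_log_mul_self_lt (√r) (Real.sqrt_pos.2 h0) (Real.sqrt_le_one.2 h1)
    rw [Real.log_sqrt h0.le] at h
    have h3 := (sq_lt_one_iff_abs_lt_one _).2 h
    rw [mul_pow, Real.sq_sqrt h0.le] at h3
    nlinarith

lemma sum_eig_mul_logb_sq_le (ρ : DensityOperator ι) :
    ∑ a, diagIn ρ.basis ρ.mat a * (-Real.logb 2 (ρ.eig a)) ^ 2 ≤ varianceBound ι := by
  simp only [diagIn_basis, neg_sq]
  refine (Finset.sum_le_sum fun a _ => mul_logb_sq_le (ρ.eig_nonneg a) (ρ.eig_le_one a)).trans ?_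
  simp [varianceBound]

lemma sum_diagIn_mul_logb_sq_le (ρ σ : DensityOperator ι) {c : ℝ} (hc : 0 < c)
    (hσ : ∀ a, c ≤ σ.eig a) :
    ∑ a, diagIn σ.basis ρ.mat a * (-Real.logb 2 (σ.eig a)) ^ 2 ≤ Real.logb 2 c ^ 2 := by
  rw [← one_mul (Real.logb 2 c ^ 2), ← sum_diagIn_eq_one ρ σ.basis_unitary, Finset.sum_mul]
  refine Finset.sum_le_sum fun a _ => mul_le_mul_of_nonneg_left ?_ (diagIn_nonneg ρ.posSemidef a)
  have h1 := Real.logb_le_logb_of_le one_lt_two hc (hσ a)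
  have h2 := Real.logb_nonpos one_lt_two (σ.eig_nonneg a) (σ.eig_le_one a)
  nlinarith

/-- Measuring a product state in a product eigenbasis of the `σ i` gives independent outcomes, and
`-logb 2` of the eigenvalue has mean `crossEntropy (ρ i) (σ i)`; Chebyshev applies. -/
lemma sum_atypical_le (ρ σ : Fin n → DensityOperator ι) {V : ℝ}
    (hV : ∀ i, ∑ a, diagIn (σ i).basis (ρ i).mat a * (-Real.logb 2 ((σ i).eig a)) ^ 2 ≤ V)
    {t : ℝ} (ht : 0 < t) (G : Finset (Fin n → ι))
    (hG : ∀ a ∈ G, t ≤ |∑ i, -Real.logb 2 ((σ i).eig (a i)) - ∑ i, crossEntropy (ρ i) (σ i)|) :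
    ∑ a ∈ G, diagIn (tens fun i => (σ i).basis) (tensor ρ) a ≤ n * V / t ^ 2 := by
  simp only [tensor_eq_tens, diagIn_tens fun i => (ρ i).posSemidef]
  refine chebyshev (q := fun i a => diagIn (σ i).basis (ρ i).mat a)
    (fun i a => diagIn_nonneg (ρ i).posSemidef a)
    (fun i => sum_diagIn_eq_one (ρ i) (σ i).basis_unitary)
    (fun i a => -Real.logb 2 ((σ i).eig a)) hV ht G ?_
  simpa only [crossEntropy, mul_neg, Finset.sum_neg_distrib] using hG

lemma prod_eig_nonneg (σ : Fin n → DensityOperator ι) (a : Fin n → ι) :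
    0 ≤ ∏ i, (σ i).eig (a i) :=
  Finset.prod_nonneg fun _ _ => eig_nonneg _ _

lemma prod_eig_le_one (σ : Fin n → DensityOperator ι) (a : Fin n → ι) :
    ∏ i, (σ i).eig (a i) ≤ 1 :=
  Finset.prod_le_one (fun _ _ => eig_nonneg _ _) fun _ _ => eig_le_one _ _

/-- Fails for a vanishing product, since `Real.logb 2 0 = 0` lets a zero eigenvalue count as 1. -/
lemma prod_eig_eq_rpow (σ : Fin n → DensityOperator ι) (a : Fin n → ι)
    (h : 0 < ∏ i, (σ i).eig (a i)) :
    ∏ i, (σ i).eig (a i) = (2 : ℝ) ^ (-∑ i, -Real.logb 2 ((σ i).eig (a i))) := by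
  have hne : ∀ i ∈ Finset.univ, (σ i).eig (a i) ≠ 0 := Finset.prod_ne_zero_iff.1 h.ne'
  rw [Finset.sum_neg_distrib, neg_neg, ← Real.logb_prod _ _ hne,
    Real.rpow_logb two_pos (by norm_num) h]

lemma prod_eig_le_rpow (σ : Fin n → DensityOperator ι) (a : Fin n → ι) {L : ℝ}
    (h : L ≤ ∑ i, -Real.logb 2 ((σ i).eig (a i))) :
    ∏ i, (σ i).eig (a i) ≤ (2 : ℝ) ^ (-L) := by
  rcases (prod_eig_nonneg σ a).eq_or_lt with h0 | h0
  · rw [← h0]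
    positivity
  · rw [prod_eig_eq_rpow σ a h0]
    exact Real.rpow_le_rpow_of_exponent_le one_le_two (neg_le_neg h)

lemma rpow_le_prod_eig (σ : Fin n → DensityOperator ι) (a : Fin n → ι)
    (h0 : 0 < ∏ i, (σ i).eig (a i)) {L : ℝ} (h : ∑ i, -Real.logb 2 ((σ i).eig (a i)) ≤ L) :
    (2 : ℝ) ^ (-L) ≤ ∏ i, (σ i).eig (a i) := by
  rw [prod_eig_eq_rpow σ a h0]
  exact Real.rpow_le_rpow_of_exponent_le one_le_two (neg_le_neg h)

/-- The expectation of a test is controlled by its trace, off the atypical part. -/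
lemma trace_tensor_mul_le (ρ : Fin n → DensityOperator ι) {E : Matrix (Fin n → ι) (Fin n → ι) ℂ}
    (hE : E.PosSemidef) (hE1 : (1 - E).PosSemidef) {t : ℝ} (ht : 0 < t) :
    (trace (tensor ρ * E)).re ≤
      (2 : ℝ) ^ (-(∑ i, (ρ i).entropy - t)) * (trace E).re + n * varianceBound ι / t ^ 2 := by
  classical
  set U := tens fun i => (ρ i).basis with hU
  set H : Finset (Fin n → ι) := Finset.univ.filter fun a =>
    ∑ i, (ρ i).entropy - t ≤ ∑ i, -Real.logb 2 ((ρ i).eig (a i)) with hH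
  have htail : ∑ a ∈ Hᶜ, ∏ i, (ρ i).eig (a i) ≤ n * varianceBound ι / t ^ 2 := by
    have h := sum_atypical_le ρ ρ (fun i => sum_eig_mul_logb_sq_le (ρ i)) ht Hᶜ (fun a ha => ?_)
    · simpa only [tensor_eq_diagMat, diagIn_diagMat (tens_basis_unitary ρ)] using h
    · simp only [hH, Finset.mem_compl, Finset.mem_filter_univ, not_le] at ha
      simp only [crossEntropy_self]
      rw [abs_sub_comm]
      exact le_trans (by linarith) (le_abs_self _)
  have he : ∀ a, 0 ≤ diagIn U E a := fun a => diagIn_nonneg hE a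
  have he1 : ∀ a, diagIn U E a ≤ 1 := fun a => diagIn_le_one (tens_basis_unitary ρ) hE1 a
  rw [tensor_eq_diagMat, trace_diagMat_mul, ← Finset.sum_add_sum_compl H]
  refine add_le_add ?_ (le_trans (Finset.sum_le_sum fun a _ => ?_) htail)
  · rw [← sum_diagIn (tens_basis_unitary ρ) E, Finset.mul_sum]
    refine le_trans (Finset.sum_le_sum fun a ha => ?_)
      (Finset.sum_le_univ_sum_of_nonneg fun a => mul_nonneg (by positivity) (he a))
    refine mul_le_mul_of_nonneg_right (prod_eig_le_rpow ρ a ?_) (he a)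
    simpa [hH] using ha
  · exact mul_le_of_le_one_right (prod_eig_nonneg ρ a) (he1 a)

end DensityOperator

variable {κ : Type*} [Fintype κ] [DecidableEq κ]

/-- The projection onto the span of the columns of `U` with index in `G`. -/
def spanProj (U : Matrix κ κ ℂ) (G : Finset κ) : Matrix κ κ ℂ :=
  diagMat U fun a => if a ∈ G then 1 else 0

lemma spanProj_posSemidef (U : Matrix κ κ ℂ) (G : Finset κ) : (spanProj U G).PosSemidef :=
  diagMat_posSemidef U fun a => by split_ifs <;> norm_num

lemma spanProj_conjTranspose (U : Matrix κ κ ℂ) (G : Finset κ) :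
    (spanProj U G)ᴴ = spanProj U G := diagMat_isHermitian _ _

lemma spanProj_mul_self {U : Matrix κ κ ℂ} (hU : Uᴴ * U = 1) (G : Finset κ) :
    spanProj U G * spanProj U G = spanProj U G := by
  rw [spanProj, diagMat_mul hU]
  congr 1
  ext a
  by_cases h : a ∈ G <;> simp [h]

lemma spanProj_add_compl {U : Matrix κ κ ℂ} (hU : Uᴴ * U = 1) (G : Finset κ) :
    spanProj U G + spanProj U Gᶜ = 1 := by
  rw [spanProj, spanProj, ← diagMat_add, ← diagMat_one hU]
  congr 1
  ext a
  by_cases h : a ∈ G <;> simp [h]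

lemma one_sub_spanProj_posSemidef {U : Matrix κ κ ℂ} (hU : Uᴴ * U = 1) (G : Finset κ) :
    (1 - spanProj U G).PosSemidef := by
  rw [← spanProj_add_compl hU G, add_sub_cancel_left]
  exact spanProj_posSemidef _ _

lemma trace_mul_spanProj (U E : Matrix κ κ ℂ) (G : Finset κ) :
    (trace (E * spanProj U G)).re = ∑ a ∈ G, diagIn U E a := by
  rw [trace_mul_comm, spanProj, trace_diagMat_mul]
  simp

lemma trace_spanProj {U : Matrix κ κ ℂ} (hU : Uᴴ * U = 1) (G : Finset κ) :
    (trace (spanProj U G)).re = G.card := by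
  rw [spanProj, trace_diagMat hU]
  simp

omit [DecidableEq κ] in
/-- The pinching inequality. -/
lemma pinching_posSemidef {X Y D : Matrix κ κ ℂ} (hX : Xᴴ = X) (hY : Yᴴ = Y)
    (hD : D.PosSemidef) {θ : ℝ} (hθ : 0 < θ) :
    ((1 + θ) • (X * D * X) + (1 + θ⁻¹) • (Y * D * Y) - (X + Y) * D * (X + Y)).PosSemidef := by
  -- Completing the square: the cross terms cancel exactly.
  have h := (hD.mul_mul_conjTranspose_same (θ • X - Y)).smul (inv_nonneg.2 hθ.le)
  have e : (1 + θ) • (X * D * X) + (1 + θ⁻¹) • (Y * D * Y) - (X + Y) * D * (X + Y) =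
      θ⁻¹ • ((θ • X - Y) * D * (θ • X - Y)ᴴ) := by
    rw [conjTranspose_sub, conjTranspose_smul, hX, hY]
    simp only [star_trivial, Matrix.sub_mul, Matrix.mul_sub, Matrix.add_mul, Matrix.mul_add,
      Matrix.smul_mul, Matrix.mul_smul, smul_sub, smul_smul]
    have h1 : θ⁻¹ * (θ * θ) = θ := by field_simp
    have h2 : θ⁻¹ * θ = 1 := inv_mul_cancel₀ hθ.ne'
    simp only [h1, h2]
    module
  rw [e]
  exact h

/-- Lower bound for the second kind of error of a test, for product states. -/
lemma strong_converse_testing (ρ σ : Fin n → DensityOperator ι) {c : ℝ} (hc : 0 < c)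
    (hσ : ∀ i a, c ≤ (σ i).eig a) {D : Matrix (Fin n → ι) (Fin n → ι) ℂ} (hD : D.PosSemidef)
    (hD1 : (1 - D).PosSemidef) {t : ℝ} (ht : 0 < t) :
    ((trace (tensor ρ * D)).re / 2 - n * (Real.logb 2 c ^ 2 + varianceBound ι) / t ^ 2) *
      (2 : ℝ) ^ (-(∑ i, (crossEntropy (ρ i) (σ i) - (ρ i).entropy)) - 2 * t) ≤
      (trace (tensor σ * D)).re := by
  classical
  set U := tens fun i => (σ i).basis with hU
  have hUu : Uᴴ * U = 1 := tens_basis_unitary σ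
  set A := ∑ i, crossEntropy (ρ i) (σ i) with hA
  set S := ∑ i, (ρ i).entropy with hS
  -- On these eigenvectors the eigenvalue of `tensor σ` is at least `2 ^ (-(A + t))`, so traces
  -- there are controlled by `tensor σ`; `tensor ρ` has little mass elsewhere.
  set G : Finset (Fin n → ι) := Finset.univ.filter fun a =>
    ∑ i, -Real.logb 2 ((σ i).eig (a i)) ≤ A + t with hG
  set Q := spanProj U G with hQ
  set R := spanProj U Gᶜ with hR
  have hQR : Q + R = 1 := spanProj_add_compl hUu G
  have hQh : Qᴴ = Q := spanProj_conjTranspose _ _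
  have hRh : Rᴴ = R := spanProj_conjTranspose _ _
  have hQQ : Q * Q = Q := spanProj_mul_self hUu G
  have hRR : R * R = R := spanProj_mul_self hUu Gᶜ
  have htail : (trace (tensor ρ * R)).re ≤ n * Real.logb 2 c ^ 2 / t ^ 2 := by
    rw [hR, trace_mul_spanProj]
    refine sum_atypical_le ρ σ (fun i => sum_diagIn_mul_logb_sq_le (ρ i) (σ i) hc (hσ i)) ht _ ?_
    intro a ha
    simp only [hG, Finset.mem_compl, Finset.mem_filter_univ, not_le] at ha
    exact le_trans (by linarith) (le_abs_self _)
  have hE : (Q * D * Q).PosSemidef := by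
    have := hD.mul_mul_conjTranspose_same Q
    rwa [hQh] at this
  have hE1 : (1 - Q * D * Q).PosSemidef := by
    have h := (hD1.mul_mul_conjTranspose_same Q).add (one_sub_spanProj_posSemidef hUu G)
    rw [hQh, Matrix.mul_sub, Matrix.sub_mul, Matrix.mul_one, hQQ] at h
    convert h using 1
    rw [← hQ]
    abel
  have hRD : (trace (tensor ρ * (R * D * R))).re ≤ (trace (tensor ρ * R)).re := by
    have h := trace_mul_re_nonneg (tensor_posSemidef ρ) (hD1.mul_mul_conjTranspose_same R)
    rw [hRh, Matrix.mul_sub, Matrix.sub_mul, Matrix.mul_one, hRR, Matrix.mul_sub, trace_sub,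
      Complex.sub_re] at h
    linarith
  -- `D` need not commute with `Q`; pinching at `θ = 1` removes the off-diagonal blocks at the price
  -- of a factor 2.
  have hpinch : (trace (tensor ρ * D)).re ≤ 2 * (trace (tensor ρ * (Q * D * Q))).re +
      2 * (trace (tensor ρ * (R * D * R))).re := by
    have h := trace_mul_re_nonneg (tensor_posSemidef ρ)
      (pinching_posSemidef hQh hRh hD one_pos)
    rw [hQR, Matrix.one_mul, Matrix.mul_one, Matrix.mul_sub, Matrix.mul_add, trace_sub, trace_add,
      Matrix.mul_smul, Matrix.mul_smul, trace_smul, trace_smul, Complex.sub_re, Complex.add_re,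
      Complex.smul_re, Complex.smul_re] at h
    norm_num at h
    linarith
  have hmain := trace_tensor_mul_le ρ hE hE1 ht
  have hQD : (trace (Q * D * Q)).re = ∑ a ∈ G, diagIn U D a := by
    rw [trace_mul_comm, ← Matrix.mul_assoc, hQQ, trace_mul_comm, hQ, trace_mul_spanProj]
  have hσD : (2 : ℝ) ^ (-(A + t)) * (trace (Q * D * Q)).re ≤ (trace (tensor σ * D)).re := by
    rw [hQD, tensor_eq_diagMat, trace_diagMat_mul, Finset.mul_sum]
    refine le_trans (Finset.sum_le_sum fun a ha => ?_)
      (Finset.sum_le_univ_sum_of_nonneg fun a =>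
        mul_nonneg (prod_eig_nonneg σ a) (diagIn_nonneg hD a))
    refine mul_le_mul_of_nonneg_right (rpow_le_prod_eig σ a ?_ ?_) (diagIn_nonneg hD a)
    · exact Finset.prod_pos fun i _ => hc.trans_le (hσ i _)
    · simpa [hG] using ha
  have hkey : (trace (tensor ρ * D)).re / 2 - n * (Real.logb 2 c ^ 2 + varianceBound ι) / t ^ 2 ≤
      (2 : ℝ) ^ (-(S - t)) * (trace (Q * D * Q)).re := by
    rw [mul_add, add_div]
    linarith
  have e : (2 : ℝ) ^ (-(∑ i, (crossEntropy (ρ i) (σ i) - (ρ i).entropy)) - 2 * t) *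
      (2 : ℝ) ^ (-(S - t)) = (2 : ℝ) ^ (-(A + t)) := by
    rw [← Real.rpow_add two_pos, Finset.sum_sub_distrib]
    congr 1
    ring
  refine le_trans (mul_le_mul_of_nonneg_right hkey (by positivity)) (le_trans (le_of_eq ?_) hσD)
  rw [← e]
  ring

end Typical

end QChannel

/-! ### Block codes and the strong converse -/

namespace QChannel

open Matrix DensityOperator

variable {ι : Type*} [Fintype ι] [DecidableEq ι] {𝒲 : ℕ → Set (DensityOperator ι)} {n : ℕ}

namespace BlockCode

lemma hasSum_trace (c : BlockCode 𝒲 n) (E : Matrix (Fin n → ι) (Fin n → ι) ℂ) :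
    HasSum (fun m => (trace (E * c.observable m)).re) (trace E).re := by
  let φ : Matrix (Fin n → ι) (Fin n → ι) ℂ →+ ℝ :=
    Complex.reAddGroupHom.comp ((traceAddMonoidHom (Fin n → ι) ℂ).comp (AddMonoidHom.mulLeft E))
  have hφ : Continuous φ := Complex.continuous_re.comp
    ((continuous_const.matrix_mul continuous_id).matrix_trace)
  have h := c.observable_sum.map φ hφ
  have e : φ 1 = (trace E).re := by
    change (trace (E * 1)).re = _
    rw [Matrix.mul_one]
  rw [e] at h
  exact h

lemma sum_trace_le (c : BlockCode 𝒲 n) {E : Matrix (Fin n → ι) (Fin n → ι) ℂ}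
    (hE : E.PosSemidef) :
    ∑ m ∈ c.messages, (trace (E * c.observable m)).re ≤ (trace E).re :=
  sum_le_hasSum _ (fun m _ => trace_mul_re_nonneg hE (c.observable_nonneg m)) (c.hasSum_trace E)

lemma one_sub_observable_posSemidef (c : BlockCode 𝒲 n) (m : c.Index) :
    (1 - c.observable m).PosSemidef := by
  refine PosSemidef.of_dotProduct_mulVec_nonneg
    (isHermitian_one.sub (c.observable_nonneg m).1) fun x => ?_
  let φ : Matrix (Fin n → ι) (Fin n → ι) ℂ →+ ℂ :=
    { toFun := fun M => star x ⬝ᵥ M *ᵥ x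
      map_zero' := by simp
      map_add' := fun M N => by rw [add_mulVec, dotProduct_add] }
  have hφ : Continuous φ :=
    continuous_const.dotProduct (continuous_id.matrix_mulVec continuous_const)
  have h := le_hasSum (c.observable_sum.map φ hφ) m
    fun k _ => (c.observable_nonneg k).dotProduct_mulVec_nonneg x
  rw [sub_mulVec, dotProduct_sub, sub_nonneg]
  exact h

lemma le_successProb {c : BlockCode 𝒲 n} {lam : ℝ} (hc : c.maxError ≤ lam) (m : c.messages) :
    1 - lam ≤ c.successProb m := by
  have h := (Finset.sup'_le_iff _ _).1 hc m (Finset.mem_attach _ m)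
  linarith

lemma one_sub_tensor_posSemidef (ρ : Fin n → DensityOperator ι) :
    (1 - tensor ρ).PosSemidef := by
  rw [tensor_eq_diagMat, ← diagMat_one (tens_basis_unitary ρ), ← diagMat_sub]
  exact diagMat_posSemidef _ fun a => sub_nonneg.2 (prod_eig_le_one ρ a)

/-- If every `Tr (f(m) D_m)` gives the bound `β ≤ Tr (E D_m)`, then `|ℳ| β ≤ Tr E`. -/
lemma card_mul_le (c : BlockCode 𝒲 n) {E : Matrix (Fin n → ι) (Fin n → ι) ℂ} (hE : E.PosSemidef)
    {β : ℝ} (h : ∀ m : c.messages, β ≤ (trace (E * c.observable m)).re) :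
    c.messages.card * β ≤ (trace E).re := by
  refine le_trans ?_ (c.sum_trace_le hE)
  rw [← nsmul_eq_mul]
  exact Finset.card_nsmul_le_sum _ _ _ fun m hm => h ⟨m, hm⟩

/-- A product state is at most 1, so every used decoding operator has trace at least `1 - lam`,
while all traces add up to the dimension. -/
lemma card_le_of_maxError_le {c : BlockCode 𝒲 n} {lam : ℝ} (hc : c.maxError ≤ lam) :
    c.messages.card * (1 - lam) ≤ Fintype.card (Fin n → ι) := by
  have h := c.card_mul_le (E := 1) PosSemidef.one (β := 1 - lam) fun m => ?_
  · rw [trace_one, Complex.natCast_re] at h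
    exact h
  · refine (le_successProb hc m).trans ?_
    have h1 := trace_mul_re_nonneg
      (one_sub_tensor_posSemidef fun i => (c.encode m i : DensityOperator ι))
      (c.observable_nonneg m)
    rw [Matrix.sub_mul, trace_sub, Complex.sub_re] at h1
    simp only [successProb]
    linarith

/-- The one-message code. -/
def trivialCode (h𝒲 : ∀ i, (𝒲 i).Nonempty) (n : ℕ) : BlockCode 𝒲 n where
  Index := Unit
  countable_index := inferInstance
  messages := {()}
  messages_nonempty := Finset.singleton_nonempty _
  encode _ i := ⟨(h𝒲 i).some, (h𝒲 i).some_mem⟩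
  observable _ := 1
  observable_nonneg _ := PosSemidef.one
  observable_sum := hasSum_unique _

end BlockCode

lemma bddAbove_codeSizes (𝒲 : ℕ → Set (DensityOperator ι)) (n : ℕ) {lam : ℝ} (hlam : lam < 1) :
    BddAbove (codeSizes 𝒲 n lam) := by
  refine ⟨⌊(Fintype.card (Fin n → ι) : ℝ) / (1 - lam)⌋₊, ?_⟩
  rintro _ ⟨c, hc, rfl⟩
  refine Nat.le_floor ?_
  rw [le_div_iff₀ (by linarith)]
  exact BlockCode.card_le_of_maxError_le hc

lemma one_mem_codeSizes (h𝒲 : ∀ i, (𝒲 i).Nonempty) (n : ℕ) {lam : ℝ} (hlam : 0 ≤ lam) :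
    1 ∈ codeSizes 𝒲 n lam := by
  refine ⟨BlockCode.trivialCode h𝒲 n, ?_, rfl⟩
  refine Finset.sup'_le _ _ fun m _ => ?_
  simp only [BlockCode.successProb, BlockCode.trivialCode, Matrix.mul_one, trace_tensor,
    Complex.one_re]
  linarith

lemma isGreatest_maxCodeSize (h𝒲 : ∀ i, (𝒲 i).Nonempty) (n : ℕ) {lam : ℝ} (hlam0 : 0 ≤ lam)
    (hlam1 : lam < 1) : IsGreatest (codeSizes 𝒲 n lam) (maxCodeSize 𝒲 n lam) :=
  ⟨Nat.sSup_mem ⟨1, one_mem_codeSizes h𝒲 n hlam0⟩ (bddAbove_codeSizes 𝒲 n hlam1),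
    fun _ hk => le_csSup (bddAbove_codeSizes 𝒲 n hlam1) hk⟩

lemma one_le_maxCodeSize (h𝒲 : ∀ i, (𝒲 i).Nonempty) (n : ℕ) {lam : ℝ} (hlam0 : 0 ≤ lam)
    (hlam1 : lam < 1) : 1 ≤ maxCodeSize 𝒲 n lam :=
  (isGreatest_maxCodeSize h𝒲 n hlam0 hlam1).2 (one_mem_codeSizes h𝒲 n hlam0)

lemma tendsto_variance (V : ℝ) {ε : ℝ} (hε : 0 < ε) :
    Tendsto (fun n : ℕ => n * V / (n * ε) ^ 2) atTop (𝓝 0) := by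
  have h := (tendsto_inv_atTop_nhds_zero_nat (𝕜 := ℝ)).const_mul (V / ε ^ 2)
  rw [mul_zero] at h
  refine h.congr' ?_
  filter_upwards [eventually_gt_atTop 0] with n hn
  have : (n : ℝ) ≠ 0 := by positivity
  field_simp

/-- The strong converse. -/
lemma eventually_logb_maxCodeSize_le (h𝒲_meas : ∀ i, MeasurableSet (𝒲 i))
    (h𝒲_ne : ∀ i, (𝒲 i).Nonempty) {lam : ℝ} (hlam0 : 0 < lam) (hlam1 : lam < 1)
    {ε : ℝ} (hε : 0 < ε) :
    ∀ᶠ n : ℕ in atTop, Real.logb 2 (maxCodeSize 𝒲 n lam) ≤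
      ∑ i ∈ Finset.range n, capacity (𝒲 i) + n * ε := by
  have : Nonempty ι := (h𝒲_ne 0).some.nonempty_index
  obtain ⟨c, hc, hcenter⟩ := exists_divergence_center (ι := ι) (show 0 < ε / 4 by linarith)
  choose σ hσ hσ2 using fun i => hcenter (𝒲 i) (h𝒲_ne i) _
    (capacity_mem_upperBounds_ensembleValues (h𝒲_meas i))
  have hg : 0 < (1 - lam) / 4 := by linarith
  have hvar := (tendsto_variance (Real.logb 2 c ^ 2 + varianceBound ι)
    (show 0 < ε / 4 by linarith)).eventually_lt_const hg
  have hconst : ∀ᶠ n : ℕ in atTop, -Real.logb 2 ((1 - lam) / 4) / (ε / 4) ≤ n :=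
    tendsto_natCast_atTop_atTop.eventually_ge_atTop _
  filter_upwards [hvar, hconst, eventually_gt_atTop 0] with n hn1 hn2 hn0
  have hnpos : (0 : ℝ) < n := by exact_mod_cast hn0
  rw [div_le_iff₀ (by linarith)] at hn2
  obtain ⟨⟨code, herr, hcard⟩, -⟩ := isGreatest_maxCodeSize h𝒲_ne n hlam0.le hlam1
  set C := ∑ i ∈ Finset.range n, capacity (𝒲 i) with hC
  set t := n * (ε / 4) with ht
  have htpos : 0 < t := by positivity
  -- Half the success probability minus the Chebyshev error leaves `(1 - lam) / 4`. Of the four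
  -- quarters of `ε`, one is the error of the centres, two come from `2 * t`, and one absorbs this
  -- constant.
  set β : ℝ := (1 - lam) / 4 * (2 : ℝ) ^ (-(C + t) - 2 * t) with hβ
  have hβpos : 0 < β := by positivity
  have hle := code.card_mul_le (E := tensor fun i : Fin n => σ i) (tensor_posSemidef _) (β := β)
    fun m => by
      refine le_trans ?_ (strong_converse_testing (fun i => (code.encode m i : DensityOperator ι))
        (fun i => σ i) hc (fun i => hσ i) (code.observable_nonneg m)
        (code.one_sub_observable_posSemidef m) htpos)
      have h1 := BlockCode.le_successProb herr m
      rw [BlockCode.successProb] at h1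
      refine mul_le_mul (by linarith) ?_ (by positivity) (by linarith)
      refine Real.rpow_le_rpow_of_exponent_le one_le_two ?_
      have h2 : ∑ i : Fin n, (crossEntropy (code.encode m i : DensityOperator ι) (σ i) -
          (code.encode m i : DensityOperator ι).entropy) ≤
          ∑ i : Fin n, (capacity (𝒲 i) + ε / 4) :=
        Finset.sum_le_sum fun i _ => hσ2 i _ (code.encode m i).2
      rw [Finset.sum_add_distrib, Fin.sum_univ_eq_sum_range (fun i => capacity (𝒲 i))] at h2
      simp only [Finset.sum_const, Finset.card_univ, Fintype.card_fin, nsmul_eq_mul] at h2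
      linarith
  rw [trace_tensor, Complex.one_re, ← hcard] at hle
  have hN : (0 : ℝ) < maxCodeSize 𝒲 n lam := by
    exact_mod_cast one_le_maxCodeSize h𝒲_ne n hlam0.le hlam1
  have hlog := Real.logb_le_logb_of_le one_lt_two (mul_pos hN hβpos) hle
  rw [Real.logb_one, Real.logb_mul hN.ne' hβpos.ne', hβ, Real.logb_mul hg.ne' (by positivity),
    Real.logb_rpow two_pos (by norm_num)] at hlog
  linarith

end QChannel

/-! ### Typical projections and codes that cannot be enlarged -/

namespace QChannel

open Matrix DensityOperator

variable {ι : Type*} [Fintype ι] [DecidableEq ι] {n : ℕ}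

lemma exists_finite_ensemble {𝒲 : Set (DensityOperator ι)} {τ : DensityOperator ι} {h : ℝ}
    (hτ : (τ.mat, h) ∈ ensembles 𝒲) :
    ∃ (T : Type) (_ : Fintype T) (w : T → ℝ) (s : T → DensityOperator ι),
      (∀ x, 0 ≤ w x) ∧ ∑ x, w x = 1 ∧ (∀ x, s x ∈ 𝒲) ∧ ∑ x, w x • (s x).mat = τ.mat ∧
      ∑ x, w x * (s x).entropy = h := by
  obtain ⟨T, hT, w, z, hw, hw1, hz, hsum⟩ := mem_convexHull_iff_exists_fintype.1 hτ
  choose s hs hsz using hz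
  refine ⟨T, hT, w, s, hw, hw1, hs, ?_, ?_⟩
  · have := congrArg Prod.fst hsum
    simpa [Prod.fst_sum, ← hsz] using this
  · have := congrArg Prod.snd hsum
    simpa [Prod.snd_sum, ← hsz] using this

lemma exists_typical_projection (ρ : Fin n → DensityOperator ι) {t : ℝ} (ht : 0 < t) :
    ∃ E : Matrix (Fin n → ι) (Fin n → ι) ℂ, E.PosSemidef ∧ (1 - E).PosSemidef ∧
      1 - n * varianceBound ι / t ^ 2 ≤ (trace (tensor ρ * E)).re ∧
      (trace E).re ≤ (2 : ℝ) ^ (∑ i, (ρ i).entropy + t) := by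
  classical
  set U := tens fun i => (ρ i).basis with hU
  have hUu : Uᴴ * U = 1 := tens_basis_unitary ρ
  set L := ∑ i, (ρ i).entropy + t with hL
  -- Positivity is imposed because null eigenvectors could satisfy the second condition and spoil
  -- the count; discarding them loses no probability.
  set G : Finset (Fin n → ι) := Finset.univ.filter fun a =>
    0 < ∏ i, (ρ i).eig (a i) ∧ ∑ i, -Real.logb 2 ((ρ i).eig (a i)) ≤ L with hG
  have hdiag : ∀ a, diagIn U (tensor ρ) a = ∏ i, (ρ i).eig (a i) := fun a => by
    rw [tensor_eq_diagMat, diagIn_diagMat hUu]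
  have hsum : ∑ a, diagIn U (tensor ρ) a = 1 := by
    rw [sum_diagIn hUu, trace_tensor, Complex.one_re]
  refine ⟨spanProj U G, spanProj_posSemidef U G, one_sub_spanProj_posSemidef hUu G, ?_, ?_⟩
  · set H : Finset (Fin n → ι) := Finset.univ.filter fun a =>
      L < ∑ i, -Real.logb 2 ((ρ i).eig (a i)) with hH
    have htail := sum_atypical_le ρ ρ (fun i => sum_eig_mul_logb_sq_le (ρ i)) ht H fun a ha => by
      simp only [hH, Finset.mem_filter_univ] at ha
      simp only [crossEntropy_self]
      exact le_trans (by linarith) (le_abs_self _)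
    have hcompl : ∑ a ∈ Gᶜ, diagIn U (tensor ρ) a ≤ ∑ a ∈ H, diagIn U (tensor ρ) a := by
      rw [← Finset.sum_filter_ne_zero Gᶜ]
      refine Finset.sum_le_sum_of_subset_of_nonneg (fun a ha => ?_)
        fun a _ _ => diagIn_nonneg (tensor_posSemidef ρ) a
      obtain ⟨ha, hne⟩ := Finset.mem_filter.1 ha
      rw [hdiag] at hne
      have hpos := (prod_eig_nonneg ρ a).lt_of_ne' hne
      simp only [hG, Finset.mem_compl, Finset.mem_filter_univ, not_and, not_le] at ha
      simpa [hH] using ha hpos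
    rw [trace_mul_spanProj]
    have := Finset.sum_add_sum_compl G (diagIn U (tensor ρ))
    linarith
  · rw [trace_spanProj hUu]
    have h1 : (G.card : ℝ) * (2 : ℝ) ^ (-L) ≤ 1 := by
      rw [← nsmul_eq_mul, ← hsum]
      refine (Finset.card_nsmul_le_sum G _ _ fun a ha => ?_).trans
        (Finset.sum_le_univ_sum_of_nonneg fun a => diagIn_nonneg (tensor_posSemidef ρ) a)
      rw [hdiag]
      simp only [hG, Finset.mem_filter_univ] at ha
      exact rpow_le_prod_eig ρ a ha.1 ha.2
    rw [Real.rpow_neg zero_le_two, ← div_eq_mul_inv, div_le_one (by positivity)] at h1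
    exact h1

/-- `R` is the square root in the eigenbasis of `B`; the last claim is `(1 - r) ^ 2 ≤ 1 - r ^ 2` for
`0 ≤ r ≤ 1`. -/
lemma exists_sqrt_one_sub {κ : Type*} [Fintype κ] [DecidableEq κ] {B : Matrix κ κ ℂ}
    (hB : B.PosSemidef) (hB1 : (1 - B).PosSemidef) :
    ∃ R : Matrix κ κ ℂ, Rᴴ = R ∧ R * R = 1 - B ∧ (B - (1 - R) * (1 - R)).PosSemidef := by
  set U := eigU hB.1 with hU
  have hUu : Uᴴ * U = 1 := eigU_unitary _
  set b := hB.1.eigenvalues with hb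
  have hBeq : B = diagMat U b := eq_diagMat hB.1
  have hb0 : ∀ a, 0 ≤ b a := hB.eigenvalues_nonneg
  have hb1 : ∀ a, b a ≤ 1 := fun a => by
    have := diagIn_le_one hUu hB1 a
    rwa [hBeq, diagIn_diagMat hUu] at this
  have hone : (1 : Matrix κ κ ℂ) = diagMat U fun _ => 1 := (diagMat_one hUu).symm
  refine ⟨diagMat U fun a => √(1 - b a), diagMat_isHermitian _ _, ?_, ?_⟩
  · rw [diagMat_mul hUu, hBeq, hone, ← diagMat_sub]
    simp only [Real.mul_self_sqrt (sub_nonneg.2 (hb1 _))]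
  · rw [hBeq, hone, ← diagMat_sub, diagMat_mul hUu, ← diagMat_sub]
    refine diagMat_posSemidef _ fun a => ?_
    have h1 := Real.sq_sqrt (sub_nonneg.2 (hb1 a))
    have h2 := Real.sqrt_nonneg (1 - b a)
    have h3 : √(1 - b a) ≤ 1 := Real.sqrt_le_one.2 (by linarith [hb0 a])
    nlinarith

/-- The property of `M` code words with decoding operators `D` of trace at most `L`, forming
a sub-observable with success probabilities at least `1 - lam`. -/
def HasPartialCode (𝒲 : ℕ → Set (DensityOperator ι)) (n : ℕ) (lam L : ℝ) (M : ℕ) : Prop :=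
  ∃ (f : Fin M → (i : Fin n) → 𝒲 i) (D : Fin M → Matrix (Fin n → ι) (Fin n → ι) ℂ),
    (∀ m, (D m).PosSemidef) ∧ (1 - ∑ m, D m).PosSemidef ∧
    (∀ m, 1 - lam ≤ (trace (tensor (fun i => (f m i : DensityOperator ι)) * D m)).re) ∧
    ∀ m, (trace (D m)).re ≤ L

variable {𝒲 : ℕ → Set (DensityOperator ι)}

/-- The missing part of the identity becomes an extra outcome `none` that is not a message. -/
lemma HasPartialCode.mem_codeSizes {lam L : ℝ} {M : ℕ} (h : HasPartialCode 𝒲 n lam L M)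
    (hM : 0 < M) : M ∈ codeSizes 𝒲 n lam := by
  obtain ⟨f, D, hD, hD1, hf, -⟩ := h
  let c : BlockCode 𝒲 n :=
    { Index := Option (Fin M)
      countable_index := inferInstance
      messages := Finset.univ.map Function.Embedding.some
      messages_nonempty := ⟨some ⟨0, hM⟩, by simp⟩
      encode := fun m => m.1.elim (f ⟨0, hM⟩) f
      observable := fun m => m.elim (1 - ∑ k, D k) D
      observable_nonneg := by
        rintro (_ | m)
        · exact hD1
        · exact hD m
      observable_sum := by
        have h := hasSum_fintype fun m : Option (Fin M) => m.elim (1 - ∑ k, D k) D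
        simpa only [Fintype.sum_option, Option.elim_none, Option.elim_some, sub_add_cancel]
          using h }
  refine ⟨c, Finset.sup'_le _ _ fun m _ => ?_, by simp [c]⟩
  obtain ⟨_ | k, hm⟩ := m
  · simp [c] at hm
  · have := hf k
    change 1 - (trace (tensor (fun i => (f k i : DensityOperator ι)) * D k)).re ≤ lam
    linarith

/-- The empty code starts the induction, and code sizes are bounded. -/
lemma exists_maximal_partialCode (𝒲 : ℕ → Set (DensityOperator ι)) (n : ℕ) {lam L : ℝ}
    (hlam1 : lam < 1) :
    ∃ M, HasPartialCode 𝒲 n lam L M ∧ ¬ HasPartialCode 𝒲 n lam L (M + 1) := by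
  by_contra! hcon
  have hall : ∀ M, HasPartialCode 𝒲 n lam L M := fun M => by
    induction M with
    | zero => exact ⟨fun m => m.elim0, fun m => m.elim0, fun m => m.elim0, by
        simpa using PosSemidef.one, fun m => m.elim0, fun m => m.elim0⟩
    | succ M ih => exact hcon M ih
  obtain ⟨K, hK⟩ := bddAbove_codeSizes 𝒲 n hlam1
  have := hK ((hall (K + 1)).mem_codeSizes K.succ_pos)
  omega

/-- If a code cannot be enlarged, then its decoding operators absorb a fixed part of every
product state of entropy at most `log L - t`. -/
lemma le_trace_of_maximal {lam : ℝ} (hlam0 : 0 < lam) {S t : ℝ} (ht : 0 < t) {M : ℕ}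
    {f : Fin M → (i : Fin n) → 𝒲 i} {D : Fin M → Matrix (Fin n → ι) (Fin n → ι) ℂ}
    (hD : ∀ m, (D m).PosSemidef) (hD1 : (1 - ∑ m, D m).PosSemidef)
    (hf : ∀ m, 1 - lam ≤ (trace (tensor (fun i => (f m i : DensityOperator ι)) * D m)).re)
    (hDL : ∀ m, (trace (D m)).re ≤ (2 : ℝ) ^ (S + t))
    (hmax : ¬ HasPartialCode 𝒲 n lam ((2 : ℝ) ^ (S + t)) (M + 1))
    (g : (i : Fin n) → 𝒲 i) (hg : ∑ i, (g i : DensityOperator ι).entropy ≤ S) :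
    lam ^ 2 - n * varianceBound ι / t ^ 2 ≤
      (1 + lam⁻¹) * (trace (tensor (fun i => (g i : DensityOperator ι)) * ∑ m, D m)).re := by
  set ρ : Fin n → DensityOperator ι := fun i => g i with hρ
  set B := ∑ m, D m with hB
  have hBpos : B.PosSemidef := posSemidef_sum _ fun m _ => hD m
  obtain ⟨E, hE, hE1, hEρ, hEtr⟩ := exists_typical_projection ρ ht
  obtain ⟨R, hRh, hRR, hRB⟩ := exists_sqrt_one_sub hBpos hD1
  have hnew : (R * E * R).PosSemidef := by
    have := hE.mul_mul_conjTranspose_same R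
    rwa [hRh] at this
  have hnew1 : (1 - B - R * E * R).PosSemidef := by
    have := hE1.mul_mul_conjTranspose_same R
    rwa [hRh, Matrix.mul_sub, Matrix.sub_mul, Matrix.mul_one, hRR] at this
  have hnewtr : (trace (R * E * R)).re ≤ (2 : ℝ) ^ (S + t) := by
    rw [trace_mul_comm, ← Matrix.mul_assoc, hRR, Matrix.sub_mul, Matrix.one_mul, trace_sub,
      Complex.sub_re]
    have h1 := trace_mul_re_nonneg hBpos hE
    have h2 : (2 : ℝ) ^ (∑ i, (ρ i).entropy + t) ≤ (2 : ℝ) ^ (S + t) :=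
      Real.rpow_le_rpow_of_exponent_le one_le_two (by linarith)
    linarith
  -- Otherwise `g`, decoded by `R * E * R`, could be appended to the code.
  have hlt : (trace (tensor ρ * (R * E * R))).re < 1 - lam := by
    by_contra! hcon
    refine hmax ⟨Fin.snoc (α := fun _ => (i : Fin n) → 𝒲 i) f g,
      Fin.snoc (α := fun _ => Matrix (Fin n → ι) (Fin n → ι) ℂ) D (R * E * R), ?_, ?_, ?_, ?_⟩
    · exact Fin.lastCases (by simpa using hnew) fun m => by simpa using hD m
    · rw [Fin.sum_univ_castSucc]
      simpa [← sub_sub] using hnew1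
    · exact Fin.lastCases (by simpa using hcon) fun m => by simpa using hf m
    · exact Fin.lastCases (by simpa using hnewtr) fun m => by simpa using hDL m
  have hR1h : (1 - R)ᴴ = 1 - R := by rw [conjTranspose_sub, conjTranspose_one, hRh]
  have hsecond : (trace (tensor ρ * ((1 - R) * E * (1 - R)))).re ≤ (trace (tensor ρ * B)).re := by
    have h := trace_mul_re_nonneg (tensor_posSemidef ρ)
      ((hE1.mul_mul_conjTranspose_same (1 - R)).add hRB)
    rw [hR1h] at h
    have e : (1 - R) * (1 - E) * (1 - R) + (B - (1 - R) * (1 - R)) =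
        B - (1 - R) * E * (1 - R) := by noncomm_ring
    rw [e, Matrix.mul_sub, trace_sub, Complex.sub_re] at h
    linarith
  -- With `θ = lam` the first term is below `(1 + lam) * (1 - lam) = 1 - lam ^ 2`, leaving `lam ^ 2`
  -- to be accounted for by `B`.
  have hpinch := trace_mul_re_nonneg (tensor_posSemidef ρ)
    (pinching_posSemidef hRh hR1h hE hlam0)
  rw [add_sub_cancel, Matrix.one_mul, Matrix.mul_one, Matrix.mul_sub, Matrix.mul_add, trace_sub,
    trace_add, Matrix.mul_smul, Matrix.mul_smul, trace_smul, trace_smul, Complex.sub_re,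
    Complex.add_re, Complex.smul_re, Complex.smul_re, smul_eq_mul, smul_eq_mul] at hpinch
  have h1 := mul_le_mul_of_nonneg_left hsecond (show 0 ≤ 1 + lam⁻¹ by positivity)
  have h2 := mul_le_mul_of_nonneg_left hlt.le (show 0 ≤ 1 + lam by linarith)
  nlinarith

end QChannel

/-! ### Direct coding theorem and conclusion -/

namespace QChannel

open Matrix DensityOperator

variable {ι : Type*} [Fintype ι] [DecidableEq ι] {𝒲 : ℕ → Set (DensityOperator ι)}

/-- The direct coding theorem for a given block length. -/
lemma le_maxCodeSize {n : ℕ} {lam : ℝ} (hlam0 : 0 < lam) (hlam1 : lam < 1)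
    {τ : ℕ → DensityOperator ι} {h : ℕ → ℝ} (hτ : ∀ i, ((τ i).mat, h i) ∈ ensembles (𝒲 i))
    {t μ : ℝ} (ht : 0 < t) (hμ0 : 0 < μ) (hμ : (1 + lam⁻¹) * μ = lam ^ 2 / 2)
    (hv1 : n * varianceBound ι / t ^ 2 ≤ lam ^ 2 / 2) (hv2 : n * varianceBound ι / t ^ 2 ≤ μ / 4)
    (hv3 : n * Real.logb 2 (Fintype.card ι) ^ 2 / t ^ 2 ≤ 1 / 2) :
    μ / 4 * (2 : ℝ) ^ (∑ i ∈ Finset.range n, ((τ i).entropy - h i) - 3 * t) ≤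
      maxCodeSize 𝒲 n lam := by
  classical
  choose T hT w s hw hw1 hs hmean hent using fun i : Fin n => exists_finite_ensemble (hτ i)
  -- The margin `t` lets Chebyshev show that a random ensemble word has entropy at most `S` with
  -- probability at least one half.
  set S := ∑ i : Fin n, h i + t with hS
  obtain ⟨M, hM, hmax⟩ := exists_maximal_partialCode 𝒲 n (L := (2 : ℝ) ^ (S + t)) hlam1
  have hMcode := hM
  obtain ⟨f, D, hD, hD1, hf, hDL⟩ := hM
  set B := ∑ m, D m with hB
  have hBpos : B.PosSemidef := posSemidef_sum _ fun m _ => hD m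
  set p : (∀ i, T i) → ℝ := fun x => ∏ i, w i (x i) with hp
  have hp0 : ∀ x, 0 ≤ p x := fun x => Finset.prod_nonneg fun i _ => hw i _
  set G : Finset (∀ i, T i) := Finset.univ.filter fun x => ∑ i, (s i (x i)).entropy ≤ S with hG
  have hGprob : 1 / 2 ≤ ∑ x ∈ G, p x := by
    have htail := chebyshev hw hw1 (fun i x => (s i x).entropy)
      (V := Real.logb 2 (Fintype.card ι) ^ 2) (fun i => by
        rw [← one_mul (Real.logb 2 _ ^ 2), ← hw1 i, Finset.sum_mul]
        exact Finset.sum_le_sum fun x _ => mul_le_mul_of_nonneg_left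
          (pow_le_pow_left₀ (entropy_nonneg _) (entropy_le_logb_card _) 2) (hw i x)) ht Gᶜ
      fun x hx => by
        simp only [hG, Finset.mem_compl, Finset.mem_filter_univ, not_le] at hx
        simp only [hent]
        exact le_trans (by linarith) (le_abs_self _)
    have h1 := Finset.sum_add_sum_compl G p
    rw [hp, sum_prod_eq_one hw1] at h1
    linarith
  have hgood : ∀ x ∈ G, μ ≤ (trace (tensor (fun i => s i (x i)) * B)).re := by
    intro x hx
    have h1 := le_trace_of_maximal hlam0 ht hD hD1 hf hDL hmax
      (fun i => ⟨s i (x i), hs i (x i)⟩) (by simpa [hG] using hx)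
    refine le_of_mul_le_mul_left (a := 1 + lam⁻¹) ?_ (by positivity)
    rw [hμ]
    linarith
  have havg : ∑ x, p x * (trace (tensor (fun i => s i (x i)) * B)).re =
      (trace (tensor (fun i : Fin n => τ i) * B)).re := by
    have e := sum_smul_tens w fun i x => (s i x).mat
    simp only [hmean] at e
    rw [tensor_eq_tens, ← e, Finset.sum_mul, trace_sum, Complex.re_sum]
    refine Finset.sum_congr rfl fun x _ => ?_
    rw [Matrix.smul_mul, trace_smul, Complex.smul_re, smul_eq_mul, tensor_eq_tens]
  have hlower : μ / 2 ≤ (trace (tensor (fun i : Fin n => τ i) * B)).re := by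
    rw [← havg]
    have h1 : ∑ x ∈ G, p x * μ ≤ ∑ x, p x * (trace (tensor (fun i => s i (x i)) * B)).re :=
      (Finset.sum_le_sum fun x hx => mul_le_mul_of_nonneg_left (hgood x hx) (hp0 x)).trans
        (Finset.sum_le_univ_sum_of_nonneg fun x => mul_nonneg (hp0 x)
          (trace_mul_re_nonneg (tensor_posSemidef _) hBpos))
    rw [← Finset.sum_mul] at h1
    have := mul_le_mul_of_nonneg_right hGprob hμ0.le
    linarith
  -- An operator catching a fixed share of the average product state must have large trace; the tail
  -- `hv2` costs half of `μ / 2`.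
  have hupper := trace_tensor_mul_le (fun i : Fin n => τ i) hBpos hD1 ht
  have hBtr : (trace B).re ≤ M * (2 : ℝ) ^ (S + t) := by
    rw [hB, trace_sum, Complex.re_sum]
    refine (Finset.sum_le_sum fun m _ => hDL m).trans ?_
    simp
  have hM' : μ / 4 ≤ (2 : ℝ) ^ (-(∑ i : Fin n, (τ i).entropy - t)) * (M * (2 : ℝ) ^ (S + t)) := by
    have := mul_le_mul_of_nonneg_left hBtr
      (show 0 ≤ (2 : ℝ) ^ (-(∑ i : Fin n, (τ i).entropy - t)) by positivity)
    linarith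
  have hMle : μ / 4 * (2 : ℝ) ^ (∑ i ∈ Finset.range n, ((τ i).entropy - h i) - 3 * t) ≤ M := by
    have h1 := mul_le_mul_of_nonneg_right hM' (show 0 ≤
      (2 : ℝ) ^ (∑ i ∈ Finset.range n, ((τ i).entropy - h i) - 3 * t) by positivity)
    refine h1.trans_eq ?_
    rw [mul_comm (M : ℝ), ← mul_assoc, ← Real.rpow_add two_pos, mul_right_comm,
      ← Real.rpow_add two_pos, ← Fin.sum_univ_eq_sum_range (fun i => (τ i).entropy - h i),
      Finset.sum_sub_distrib]
    have : -(∑ i : Fin n, (τ i).entropy - t) + (S + t) +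
        (∑ i : Fin n, (τ i).entropy - ∑ i : Fin n, h i - 3 * t) = 0 := by
      rw [hS]
      ring
    rw [this, Real.rpow_zero, one_mul]
  have hMpos : 0 < M := by
    have : (0 : ℝ) < M := lt_of_lt_of_le (by positivity) hMle
    exact_mod_cast this
  refine hMle.trans ?_
  exact_mod_cast le_csSup (bddAbove_codeSizes 𝒲 n hlam1) (hMcode.mem_codeSizes hMpos)

/-- The direct coding theorem. -/
lemma eventually_le_logb_maxCodeSize (h𝒲_meas : ∀ i, MeasurableSet (𝒲 i))
    (h𝒲_ne : ∀ i, (𝒲 i).Nonempty) {lam : ℝ} (hlam0 : 0 < lam) (hlam1 : lam < 1)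
    {ε : ℝ} (hε : 0 < ε) :
    ∀ᶠ n : ℕ in atTop, ∑ i ∈ Finset.range n, capacity (𝒲 i) - n * ε ≤
      Real.logb 2 (maxCodeSize 𝒲 n lam) := by
  -- One fifth pays for the ensembles, three for `3 * t`, and one for the constant `μ / 4`.
  have hε5 : 0 < ε / 5 := by linarith
  choose τ h hτ hcap using fun i => exists_ensemble_near_capacity (h𝒲_meas i) (h𝒲_ne i) hε5
  set μ := (lam ^ 2 / 2) / (1 + lam⁻¹) with hμdef
  have hμ0 : 0 < μ := by positivity
  have hμ : (1 + lam⁻¹) * μ = lam ^ 2 / 2 := mul_div_cancel₀ _ (by positivity)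
  have hvar := tendsto_variance (varianceBound ι) hε5
  have hvar' := tendsto_variance (Real.logb 2 (Fintype.card ι) ^ 2) hε5
  have hconst : ∀ᶠ n : ℕ in atTop, -Real.logb 2 (μ / 4) / (ε / 5) ≤ n :=
    tendsto_natCast_atTop_atTop.eventually_ge_atTop _
  filter_upwards [hvar.eventually_le_const (show 0 < lam ^ 2 / 2 by positivity),
    hvar.eventually_le_const (show 0 < μ / 4 by positivity),
    hvar'.eventually_le_const (show (0 : ℝ) < 1 / 2 by norm_num), hconst,
    eventually_gt_atTop 0] with n hv1 hv2 hv3 hn hn0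
  have hnpos : (0 : ℝ) < n := by exact_mod_cast hn0
  rw [div_le_iff₀ hε5] at hn
  have hle := le_maxCodeSize hlam0 hlam1 hτ (mul_pos hnpos hε5) hμ0 hμ hv1 hv2 hv3
  have hlog := Real.logb_le_logb_of_le one_lt_two (by positivity) hle
  rw [Real.logb_mul (by positivity) (by positivity), Real.logb_rpow two_pos (by norm_num)] at hlog
  have hsum : ∑ i ∈ Finset.range n, (capacity (𝒲 i) - ε / 5) ≤
      ∑ i ∈ Finset.range n, ((τ i).entropy - h i) := Finset.sum_le_sum fun i _ => (hcap i).le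
  rw [Finset.sum_sub_distrib, Finset.sum_const, Finset.card_range, nsmul_eq_mul] at hsum
  linarith

end QChannel

end

theorem mainTheorem1 {ι : Type*} [Fintype ι] [DecidableEq ι]
    (𝒲 : ℕ → Set (QChannel.DensityOperator ι))
    (h𝒲_meas : ∀ i, MeasurableSet (𝒲 i)) (h𝒲_ne : ∀ i, (𝒲 i).Nonempty)
    (lam : ℝ) (hlam0 : 0 < lam) (hlam1 : lam < 1) :
    (∀ n, IsGreatest (QChannel.codeSizes 𝒲 n lam) (QChannel.maxCodeSize 𝒲 n lam)) ∧
    (∀ i, IsLUB (QChannel.informationValues (𝒲 i)) (QChannel.capacity (𝒲 i))) ∧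
    Tendsto
      (fun n : ℕ =>
        |1 / (n : ℝ) * Real.logb 2 (QChannel.maxCodeSize 𝒲 n lam : ℝ) -
          1 / (n : ℝ) * ∑ i ∈ Finset.range n, QChannel.capacity (𝒲 i)|)
      atTop (𝓝 0) := by
  refine ⟨fun n => QChannel.isGreatest_maxCodeSize h𝒲_ne n hlam0.le hlam1,
    fun i => QChannel.isLUB_capacity (h𝒲_meas i) (h𝒲_ne i), ?_⟩
  -- This form requires only `n > N`, which makes `n` positive and allows clearing the denominator.
  rw [Metric.tendsto_atTop']
  intro ε hε
  have hε2 : 0 < ε / 2 := half_pos hε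
  obtain ⟨N, hN⟩ := eventually_atTop.1
    ((QChannel.eventually_logb_maxCodeSize_le h𝒲_meas h𝒲_ne hlam0 hlam1 hε2).and
      (QChannel.eventually_le_logb_maxCodeSize h𝒲_meas h𝒲_ne hlam0 hlam1 hε2))
  refine ⟨N, fun n hn => ?_⟩
  obtain ⟨hub, hlb⟩ := hN n hn.le
  have hnpos : (0 : ℝ) < n := by exact_mod_cast (Nat.zero_le N).trans_lt hn
  rw [Real.dist_0_eq_abs, abs_abs, ← mul_sub, abs_mul, abs_of_pos (by positivity),
    one_div, inv_mul_lt_iff₀ hnpos]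
  have : (n : ℝ) * (ε / 2) < n * ε := mul_lt_mul_of_pos_left (half_lt_self hε) hnpos
  exact lt_of_le_of_lt (abs_le.2 ⟨by linarith, by linarith⟩) this
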